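/- A subset of $\mathbb R^n$ is semialgebraic if it is a finite Boolean combination of sets $\{p>0\}$ with $p$ a real polynomial, and a map is semialgebraic if its graph is. A compact semialgebraic metric space over $\mathbb R$ is a pair $(X,d)$ of a compact semialgebraic set $X\subseteq\mathbb R^n$ and a metric $d$ on $X$ that is semialgebraic and continuous as a function on $X\times X$ with its Euclidean topology. Two such spaces are (semialgebraically) isometric if there is a (semialgebraic) distance-preserving bijection between them. Theorem 2. There exist two compact semialgebraic metric spaces over $\mathbb R$ that are isometric but not semialgebraically isometric. More precisely, let $B=\{b\in\mathbb R^2:|b|\le1\}$ and $X=(0,1]\times\mathbb R$. There exist - a semialgebraic (and continuous) metric $d_X$ on $X$ that is invariant under the translations $(x_1,x_2)\mapsto(x_1,x_2+a)$, $a\in\mathbb R$; - a continuous $2$-periodic map $g:\mathbb R\to\partial B$, bijective from $[0,2)$ onto $\partial B$, such that the covering map $f:X\to B\setminus\{0\}$, $f(x_1,x_2)=x_1g(x_2)$, is semialgebraic on $(0,1]\times[2n,2n+2]$ for every $n\in\mathbb Z$; - a semialgebraic, continuous, strictly decreasing function $\varphi:(0,1]\to\mathbb R$ with $\varphi(1)=0$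 and $\varphi(t)\to\infty$ as $t\to0$; with the following properties. Put $\tilde d_X(x,x')=d_X\big((x_1,x_2+\varphi(x_1)),(x'_1,x'_2+\varphi(x'_1))\big)$, and define $d$ and $\tilde d$ on $B$ by $$d(b,b')=\inf\{d_X(x,x'):f(x)=b,\ f(x')=b'\},\qquad \tilde d(b,b')=\inf\{\tilde d_X(x,x'):f(x)=b,\ f(x')=b'\}$$ for $b,b'\ne0$, and $d(0,b)=d(b,0)=\tilde d(0,b)=\tilde d(b,0)=|b|/2$ for $b\in B$. Then $(B,d)$ and $(B,\tilde d)$ are compact semialgebraic metric spaces; they are isometric but not semialgebraically isometric; and for every isometry $\Psi$ of $(B,\tilde d)$ onto $(B,d)$ there are $c\in\mathbb R$ and $\varepsilon\in\{1,-1\}$ with $$\Psi(f(x_1,x_2))=f\big(x_1,\,c+\varepsilon(x_2+\varphi(x_1))\big)\qquad\text{for all }(x_1,x_2)\in X,$$ so that $\Psi$ sends each radius $f((0,1]\times\{x_2\})$ to a curve that spirals infinitely often around $0$. -/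

import Mathlib

/-- Semialgebraic subsets of `ℝ^ι`: the smallest class of sets that contains `{x | 0 < p x}` for
every real polynomial `p` and is closed under complements and finite unions (hence under finite
intersections, and it contains the sets `{p = 0}` and `{p ≥ 0}`). -/
inductive IsSemialgebraic {ι : Type} : Set (ι → ℝ) → Prop
  | pos (p : MvPolynomial ι ℝ) : IsSemialgebraic {x | 0 < MvPolynomial.eval x p}
  | compl {S : Set (ι → ℝ)} : IsSemialgebraic S → IsSemialgebraic Sᶜ
  | union {S T : Set (ι → ℝ)} : IsSemialgebraic S → IsSemialgebraic T → IsSemialgebraic (S ∪ T)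

/-- The map `f`, restricted to `X ⊆ ℝ^n`, is semialgebraic: its graph in `ℝ^n × ℝ^m` is a
semialgebraic set. -/
def IsSemialgebraicMapOn {n m : ℕ} (f : (Fin n → ℝ) → (Fin m → ℝ)) (X : Set (Fin n → ℝ)) : Prop :=
  IsSemialgebraic {z : Fin n ⊕ Fin m → ℝ | z ∘ Sum.inl ∈ X ∧ z ∘ Sum.inr = f (z ∘ Sum.inl)}

/-- `(X, d)` is a semialgebraic metric space: `X ⊆ ℝ^n` is a semialgebraic set and `d` is a metric
on `X` that is semialgebraic (its graph in `ℝ^n × ℝ^n × ℝ` is semialgebraic) and continuous for the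
Euclidean topology of `X × X`. Values of `d` outside `X × X` play no role. -/
structure IsSemialgebraicMetricSpace {n : ℕ} (X : Set (Fin n → ℝ))
    (d : (Fin n → ℝ) → (Fin n → ℝ) → ℝ) : Prop where
  semialgebraic_carrier : IsSemialgebraic X
  eq_zero_iff : ∀ x ∈ X, ∀ y ∈ X, d x y = 0 ↔ x = y
  symm : ∀ x ∈ X, ∀ y ∈ X, d x y = d y x
  triangle : ∀ x ∈ X, ∀ y ∈ X, ∀ z ∈ X, d x z ≤ d x y + d y z
  continuousOn : ContinuousOn (fun p : (Fin n → ℝ) × (Fin n → ℝ) => d p.1 p.2) (X ×ˢ X)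
  semialgebraic_dist : IsSemialgebraic {z : (Fin n ⊕ Fin n) ⊕ Fin 1 → ℝ |
    (fun i => z (Sum.inl (Sum.inl i))) ∈ X ∧ (fun i => z (Sum.inl (Sum.inr i))) ∈ X ∧
      z (Sum.inr 0) = d (fun i => z (Sum.inl (Sum.inl i))) (fun i => z (Sum.inl (Sum.inr i)))}

/-- A compact semialgebraic metric space: a semialgebraic metric space whose underlying set is
closed and bounded. (As the metric is continuous, it then induces the Euclidean topology.) -/
def IsCompactSemialgebraicMetricSpace {n : ℕ} (X : Set (Fin n → ℝ))
    (d : (Fin n → ℝ) → (Fin n → ℝ) → ℝ) : Prop :=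
  IsCompact X ∧ IsSemialgebraicMetricSpace X d

/-- `Ψ` restricts to an isometry of `(X, d)` onto `(Y, e)`. -/
def IsIsometryOnto {n m : ℕ} (X : Set (Fin n → ℝ)) (d : (Fin n → ℝ) → (Fin n → ℝ) → ℝ)
    (Y : Set (Fin m → ℝ)) (e : (Fin m → ℝ) → (Fin m → ℝ) → ℝ)
    (Ψ : (Fin n → ℝ) → (Fin m → ℝ)) : Prop :=
  Set.BijOn Ψ X Y ∧ ∀ x ∈ X, ∀ y ∈ X, e (Ψ x) (Ψ y) = d x y

/-- `(X, d)` and `(Y, e)` are isometric. -/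
def AreIsometric {n m : ℕ} (X : Set (Fin n → ℝ)) (d : (Fin n → ℝ) → (Fin n → ℝ) → ℝ)
    (Y : Set (Fin m → ℝ)) (e : (Fin m → ℝ) → (Fin m → ℝ) → ℝ) : Prop :=
  ∃ Ψ, IsIsometryOnto X d Y e Ψ

/-- `(X, d)` and `(Y, e)` are semialgebraically isometric. -/
def AreSemialgebraicallyIsometric {n m : ℕ}
    (X : Set (Fin n → ℝ)) (d : (Fin n → ℝ) → (Fin n → ℝ) → ℝ)
    (Y : Set (Fin m → ℝ)) (e : (Fin m → ℝ) → (Fin m → ℝ) → ℝ) : Prop :=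
  ∃ Ψ, IsIsometryOnto X d Y e Ψ ∧ IsSemialgebraicMapOn Ψ X

/-- The Euclidean norm on `ℝ²`. -/
noncomputable def planeNorm (b : Fin 2 → ℝ) : ℝ := Real.sqrt (b 0 ^ 2 + b 1 ^ 2)

/-- The closed unit disc `B ⊆ ℝ²`. -/
def closedDisc : Set (Fin 2 → ℝ) := {b | planeNorm b ≤ 1}

/-- The unit circle `∂B ⊆ ℝ²`. -/
def unitCircle : Set (Fin 2 → ℝ) := {b | planeNorm b = 1}

/-- The half-open strip `(0, 1] × ℝ ⊆ ℝ²`. -/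
def strip : Set (Fin 2 → ℝ) := {x | 0 < x 0 ∧ x 0 ≤ 1}

/-- The map `(x₁, x₂) ↦ x₁ g(x₂)`. -/
def polarMap (g : ℝ → (Fin 2 → ℝ)) (x : Fin 2 → ℝ) : Fin 2 → ℝ := x 0 • g (x 1)

/-- `g : ℝ → ∂B` is continuous, has period `2` and maps `[0, 2)` bijectively onto the circle, so that
`polarMap g` is a covering map of the strip onto the punctured disc; and `polarMap g` is
semialgebraic on every rectangle `(0, 1] × [2n, 2n + 2]`. -/
structure IsPeriodicSemialgebraicCovering (g : ℝ → (Fin 2 → ℝ)) : Prop where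
  continuous : Continuous g
  periodic : Function.Periodic g 2
  bijOn : Set.BijOn g (Set.Ico 0 2) unitCircle
  mapsTo : ∀ t, g t ∈ unitCircle
  semialgebraic : ∀ n : ℤ, IsSemialgebraicMapOn (polarMap g)
    {x | x ∈ strip ∧ 2 * (n : ℝ) ≤ x 1 ∧ x 1 ≤ 2 * (n : ℝ) + 2}

/-- `φ : (0, 1] → ℝ` is semialgebraic, continuous and strictly monotone with `φ(1) = 0` and
`φ(t) → ∞` as `t → 0`. -/
structure IsTwistFunction (φ : ℝ → ℝ) : Prop where
  semialgebraic : IsSemialgebraic {z : Fin 2 → ℝ | z 0 ∈ Set.Ioc (0 : ℝ) 1 ∧ z 1 = φ (z 0)}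
  continuousOn : ContinuousOn φ (Set.Ioc 0 1)
  strictAntiOn : StrictAntiOn φ (Set.Ioc 0 1)
  map_one : φ 1 = 0
  tendsto : Filter.Tendsto φ (nhdsWithin 0 (Set.Ioi 0)) Filter.atTop

/-- The twisted metric `((x₁, x₂), (y₁, y₂)) ↦ dX ((x₁, x₂ + φ(x₁)), (y₁, y₂ + φ(y₁)))`. -/
def twistedDist (φ : ℝ → ℝ) (dX : (Fin 2 → ℝ) → (Fin 2 → ℝ) → ℝ) (x y : Fin 2 → ℝ) : ℝ :=
  dX ![x 0, x 1 + φ (x 0)] ![y 0, y 1 + φ (y 0)]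

/-- `d` is the function on the disc obtained by pushing `dX` down along the covering
`f = polarMap g`: for `b, b' ≠ 0`, `d(b, b')` is the `dX`-distance between the fibres `f⁻¹(b)` and
`f⁻¹(b')`, and `d(0, b) = d(b, 0) = |b|/2`. -/
def IsPushedDown (g : ℝ → (Fin 2 → ℝ)) (dX d : (Fin 2 → ℝ) → (Fin 2 → ℝ) → ℝ) : Prop :=
  (∀ b ∈ closedDisc, ∀ b' ∈ closedDisc, b ≠ 0 → b' ≠ 0 →
    IsGLB {s : ℝ | ∃ x ∈ strip, ∃ x' ∈ strip,
      polarMap g x = b ∧ polarMap g x' = b' ∧ s = dX x x'} (d b b')) ∧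
  ∀ b ∈ closedDisc, d 0 b = planeNorm b / 2 ∧ d b 0 = planeNorm b / 2

/-! In coordinates (s, u) = (radius, angle), with angles in ℝ or ℝ/2ℤ, take the distance min((s +
t)/2, |1/s - 1/t| + |u - v|) and the twist φ(s) = 1/s - 1. Twisting replaces u - v by u - v + κ(1/s
- 1/t) with κ = 1, so the parameters κ = 0 and κ = 1 treat both metrics at once (`stripDist`,
`discDist`).

The first term is at most 1, so the second matters only when |1/s - 1/t| ≤ 1. There the shear is at
most 1, and only boundedly many sheets of the covering compete; hence the twisted metric on the disc
is semialgebraic although the twist winds infinitely often (`discDist_eq_foldedAbs`). Rotating the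
circle of radius s by 1/s is an isometry (`areIsometric_discDist`).

Conversely (`isIsometryOnto_rigid`), an isometry fixes 0, the only point at distance at most 1/2
from all others, so it preserves radii. Points of equal twisted angle and nearby radii are at
distance exactly |1/s - 1/t|, which leaves no room for their images to differ in angle. The isometry
therefore acts on twisted angles independently of the radius, and on the boundary circle it is a
rotation or reflection. The image of a radius is a spiral, which meets a fixed radius infinitely
often without containing an initial segment of it; along a line, a semialgebraic set cannot do so.

Semialgebraicity is proved without quantifier elimination: algebras of functions with semialgebraic
positivity sets are enlarged by piecewise definitions, inverses and square roots. The circle is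
parametrized through a diamond, so that angles are piecewise rational in the coordinates. -/

open Filter Topology

/-! ### Semialgebraic sets along polynomial curves -/

namespace IsSemialgebraic

variable {ι : Type} {S T : Set (ι → ℝ)}

theorem inter (hS : IsSemialgebraic S) (hT : IsSemialgebraic T) : IsSemialgebraic (S ∩ T) := by
  have h := (hS.compl.union hT.compl).compl
  rwa [Set.compl_union, compl_compl, compl_compl] at h

/-- Along a polynomial curve, membership in a semialgebraic set is eventually constant. -/
theorem eventually_mem_or_eventually_notMem (hS : IsSemialgebraic S) (γ : ι → Polynomial ℝ) :
    (∀ᶠ t in nhdsWithin (0 : ℝ) (Set.Ioi 0), (fun i => (γ i).eval t) ∈ S) ∨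
      ∀ᶠ t in nhdsWithin (0 : ℝ) (Set.Ioi 0), (fun i => (γ i).eval t) ∉ S := by
  induction hS with
  | pos p =>
    have key : ∀ t : ℝ, MvPolynomial.eval (fun i => (γ i).eval t) p
        = (MvPolynomial.aeval γ p).eval t := by
      intro t
      induction p using MvPolynomial.induction_on with
      | C a => simp
      | add p q hp hq => simp [hp, hq]
      | mul_X p i hp => simp [hp]
    simp only [Set.mem_ofPred_eq, key]
    generalize MvPolynomial.aeval γ p = q
    by_cases hq : q = 0
    · simp [hq]
    -- Dividing out the power of t in q leaves r with r(0) ≠ 0, and the sign of r(0) decides the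
    -- sign of q for small t > 0.
    obtain ⟨r, hr, hdvd⟩ := Polynomial.exists_eq_pow_rootMultiplicity_mul_and_not_dvd q hq 0
    have hr0 : r.eval 0 ≠ 0 := fun h => hdvd (Polynomial.dvd_iff_isRoot.2 h)
    have hpos : ∀ t ∈ Set.Ioi (0 : ℝ), (0 < q.eval t ↔ 0 < r.eval t) := by
      intro t ht
      rw [hr]
      simp [mul_pos_iff_of_pos_left (pow_pos (Set.mem_Ioi.1 ht) _)]
    have hself := self_mem_nhdsWithin (a := (0 : ℝ)) (s := Set.Ioi 0)
    rcases lt_or_gt_of_ne hr0 with h | h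
    · right
      filter_upwards [hself, (r.continuous.continuousAt.eventually_lt_const h).filter_mono
        nhdsWithin_le_nhds] with t ht h'
      rw [hpos t ht]
      exact h'.not_gt
    · left
      filter_upwards [hself, (r.continuous.continuousAt.eventually_const_lt h).filter_mono
        nhdsWithin_le_nhds] with t ht h'
      exact (hpos t ht).2 h'
  | compl _ ih => simpa [or_comm] using ih
  | union _ _ ihS ihT =>
    rcases ihS with h | h
    · exact Or.inl (h.mono fun _ => Or.inl)
    rcases ihT with h' | h'
    · exact Or.inl (h'.mono fun _ => Or.inr)
    · exact Or.inr ((h.and h').mono fun _ h => not_or.2 h)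

end IsSemialgebraic

/-! ### A calculus of semialgebraic functions -/

/-- A subalgebra of real functions on `ℝ^ι` that contains the coordinates and whose members have
semialgebraic positivity sets. -/
structure IsTame {ι : Type} (R : Subalgebra ℝ ((ι → ℝ) → ℝ)) : Prop where
  coord_mem : ∀ i, (fun x : ι → ℝ => x i) ∈ R
  pos : ∀ f ∈ R, IsSemialgebraic {x | 0 < f x}

/-- A function that can be adjoined to every tame algebra. -/
def IsTameFun {ι : Type} (f : (ι → ℝ) → ℝ) : Prop :=
  ∀ R : Subalgebra ℝ ((ι → ℝ) → ℝ), IsTame R → ∃ R', IsTame R' ∧ R ≤ R' ∧ f ∈ R'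

theorem exists_isTame (ι : Type) : ∃ R : Subalgebra ℝ ((ι → ℝ) → ℝ), IsTame R := by
  refine ⟨(MvPolynomial.aeval (fun (i : ι) (x : ι → ℝ) => x i) :
    MvPolynomial ι ℝ →ₐ[ℝ] ((ι → ℝ) → ℝ)).range, ⟨fun i => ⟨MvPolynomial.X i, by simp⟩, ?_⟩⟩
  rintro _ ⟨p, rfl⟩
  convert IsSemialgebraic.pos p using 4 with x
  induction p using MvPolynomial.induction_on with
  | C a => simp [Pi.algebraMap_apply]
  | add p q hp hq => simp_all
  | mul_X p i hp => simp_all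

namespace IsTame

variable {ι : Type} {R : Subalgebra ℝ ((ι → ℝ) → ℝ)} {f : (ι → ℝ) → ℝ}

theorem neg (hR : IsTame R) (hf : f ∈ R) : IsSemialgebraic {x | f x < 0} := by
  simpa using hR.pos _ (R.neg_mem hf)

theorem exists_piecewise (hR : IsTame R) {P : Set (ι → ℝ)} (hP : IsSemialgebraic P)
    {a b h : (ι → ℝ) → ℝ} (ha : a ∈ R) (hb : b ∈ R) (h₁ : ∀ x ∈ P, h x = a x)
    (h₂ : ∀ x ∉ P, h x = b x) : ∃ R', IsTame R' ∧ R ≤ R' ∧ h ∈ R' := by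
  refine ⟨{ carrier := {h | ∃ a ∈ R, ∃ b ∈ R, (∀ x ∈ P, h x = a x) ∧ ∀ x ∉ P, h x = b x}
            mul_mem' := ?_, add_mem' := ?_, algebraMap_mem' := ?_ }, ⟨?_, ?_⟩, ?_, ?_⟩
  · rintro _ _ ⟨a, ha, b, hb, h₁, h₂⟩ ⟨a', ha', b', hb', h₁', h₂'⟩
    exact ⟨a * a', R.mul_mem ha ha', b * b', R.mul_mem hb hb',
      fun x hx => by simp [h₁ x hx, h₁' x hx], fun x hx => by simp [h₂ x hx, h₂' x hx]⟩
  · rintro _ _ ⟨a, ha, b, hb, h₁, h₂⟩ ⟨a', ha', b', hb', h₁', h₂'⟩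
    exact ⟨a + a', R.add_mem ha ha', b + b', R.add_mem hb hb',
      fun x hx => by simp [h₁ x hx, h₁' x hx], fun x hx => by simp [h₂ x hx, h₂' x hx]⟩
  · exact fun r => ⟨_, R.algebraMap_mem r, _, R.algebraMap_mem r, fun _ _ => rfl, fun _ _ => rfl⟩
  · exact fun i => ⟨_, hR.coord_mem i, _, hR.coord_mem i, fun _ _ => rfl, fun _ _ => rfl⟩
  · rintro h ⟨a, ha, b, hb, h₁, h₂⟩
    convert (hP.inter (hR.pos a ha)).union (hP.compl.inter (hR.pos b hb)) using 1
    ext x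
    by_cases hx : x ∈ P
    · simp [hx, h₁ x hx]
    · simp [hx, h₂ x hx]
  · exact fun a ha => ⟨a, ha, a, ha, fun _ _ => rfl, fun _ _ => rfl⟩
  · exact ⟨a, ha, b, hb, h₁, h₂⟩

/-- The extension is the localization of R at f. The sign of a / f ^ k is that of a * f ^ k, because
f ^ (2k) > 0. -/
theorem exists_inv (hR : IsTame R) (hf : f ∈ R) (h0 : ∀ x, f x ≠ 0) :
    ∃ R', IsTame R' ∧ R ≤ R' ∧ f⁻¹ ∈ R' := by
  refine ⟨{ carrier := {h | ∃ a ∈ R, ∃ k : ℕ, ∀ x, h x * f x ^ k = a x}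
            mul_mem' := ?_, add_mem' := ?_, algebraMap_mem' := ?_ }, ⟨?_, ?_⟩, ?_, ?_⟩
  · rintro h h' ⟨a, ha, k, hk⟩ ⟨a', ha', k', hk'⟩
    refine ⟨a * a', R.mul_mem ha ha', k + k', fun x => ?_⟩
    simp only [Pi.mul_apply, ← hk, ← hk']
    ring
  · rintro h h' ⟨a, ha, k, hk⟩ ⟨a', ha', k', hk'⟩
    refine ⟨a * f ^ k' + a' * f ^ k, R.add_mem (R.mul_mem ha (R.pow_mem hf _))
      (R.mul_mem ha' (R.pow_mem hf _)), k + k', fun x => ?_⟩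
    simp only [Pi.mul_apply, Pi.add_apply, Pi.pow_apply, ← hk, ← hk']
    ring
  · exact fun r => ⟨_, R.algebraMap_mem r, 0, fun _ => by simp⟩
  · exact fun i => ⟨_, hR.coord_mem i, 0, fun _ => by simp⟩
  · rintro h ⟨a, ha, k, hk⟩
    convert hR.pos _ (R.mul_mem ha (R.pow_mem hf k)) using 3 with x
    have hpos : 0 < f x ^ k * f x ^ k := mul_self_pos.2 (pow_ne_zero _ (h0 x))
    simp only [Pi.mul_apply, Pi.pow_apply, ← hk, mul_assoc]
    exact (mul_pos_iff_of_pos_right hpos).symm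
  · exact fun a ha => ⟨a, ha, 0, fun _ => by simp⟩
  · exact ⟨1, R.one_mem, 1, fun x => by simp [h0 x]⟩

/-- Multiplication by the conjugate a - b√c removes the root, so the signs of a, b and a² - b²c
decide. -/
theorem pos_add_mul_sqrt_iff (a b : ℝ) {c : ℝ} (hc : 0 ≤ c) :
    0 < a + b * √c ↔
      (0 < a ∧ (¬ b < 0 ∨ 0 < a ^ 2 - b ^ 2 * c)) ∨ (0 < b ∧ 0 < b ^ 2 * c - a ^ 2) := by
  obtain ⟨s, hs, rfl⟩ : ∃ s, 0 ≤ s ∧ c = s ^ 2 := ⟨√c, Real.sqrt_nonneg c, (Real.sq_sqrt hc).symm⟩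
  rw [Real.sqrt_sq hs]
  constructor
  · intro h
    by_cases ha : 0 < a
    · refine Or.inl ⟨ha, ?_⟩
      by_cases hb : b < 0
      · right
        have h1 : 0 < a - b * s := by nlinarith
        nlinarith [mul_pos h h1]
      · exact Or.inl hb
    · have hbs : 0 < b * s := by linarith
      have hb : 0 < b := by
        by_contra hb
        nlinarith
      refine Or.inr ⟨hb, ?_⟩
      have h1 : 0 < b * s - a := by linarith
      nlinarith [mul_pos h h1]
  · rintro (⟨ha, hb | hb⟩ | ⟨hb, h⟩)
    · have : 0 ≤ b * s := mul_nonneg (not_lt.1 hb) hs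
      linarith
    · by_contra hn
      nlinarith
    · by_contra hn
      have := mul_nonneg hb.le hs
      nlinarith

/-- The extension R + R√f is closed under products since the square of √f is f. -/
theorem exists_sqrt (hR : IsTame R) (hf : f ∈ R) (h0 : ∀ x, 0 ≤ f x) :
    ∃ R', IsTame R' ∧ R ≤ R' ∧ (fun x => √(f x)) ∈ R' := by
  refine ⟨{ carrier := {h | ∃ a ∈ R, ∃ b ∈ R, ∀ x, h x = a x + b x * √(f x)}
            mul_mem' := ?_, add_mem' := ?_, algebraMap_mem' := ?_ }, ⟨?_, ?_⟩, ?_, ?_⟩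
  · rintro h h' ⟨a, ha, b, hb, hh⟩ ⟨a', ha', b', hb', hh'⟩
    refine ⟨a * a' + b * b' * f, R.add_mem (R.mul_mem ha ha') (R.mul_mem (R.mul_mem hb hb') hf),
      a * b' + b * a', R.add_mem (R.mul_mem ha hb') (R.mul_mem hb ha'), fun x => ?_⟩
    simp only [Pi.mul_apply, Pi.add_apply, hh, hh']
    linear_combination (b x * b' x) * Real.mul_self_sqrt (h0 x)
  · rintro h h' ⟨a, ha, b, hb, hh⟩ ⟨a', ha', b', hb', hh'⟩
    refine ⟨a + a', R.add_mem ha ha', b + b', R.add_mem hb hb', fun x => ?_⟩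
    simp only [Pi.add_apply, hh, hh']
    ring
  · exact fun r => ⟨_, R.algebraMap_mem r, 0, R.zero_mem, fun _ => by simp⟩
  · exact fun i => ⟨_, hR.coord_mem i, 0, R.zero_mem, fun _ => by simp⟩
  · rintro h ⟨a, ha, b, hb, hh⟩
    have hu : a ^ 2 - b ^ 2 * f ∈ R :=
      R.sub_mem (R.pow_mem ha 2) (R.mul_mem (R.pow_mem hb 2) hf)
    have hv : b ^ 2 * f - a ^ 2 ∈ R :=
      R.sub_mem (R.mul_mem (R.pow_mem hb 2) hf) (R.pow_mem ha 2)
    convert ((hR.pos a ha).inter ((hR.neg hb).compl.union (hR.pos _ hu))).union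
      ((hR.pos b hb).inter (hR.pos _ hv)) using 1
    ext x
    simp only [Set.mem_ofPred_eq, hh, pos_add_mul_sqrt_iff _ _ (h0 x)]
    rfl
  · exact fun a ha => ⟨a, ha, 0, R.zero_mem, fun _ => by simp⟩
  · exact ⟨0, R.zero_mem, 1, R.one_mem, fun _ => by simp⟩

end IsTame

namespace IsTameFun

variable {ι : Type} {f g h : (ι → ℝ) → ℝ}

theorem coord (i : ι) : IsTameFun fun x : ι → ℝ => x i :=
  fun R hR => ⟨R, hR, le_rfl, hR.coord_mem i⟩

theorem const (c : ℝ) : IsTameFun fun _ : ι → ℝ => c :=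
  fun R hR => ⟨R, hR, le_rfl, R.algebraMap_mem c⟩

theorem add (hf : IsTameFun f) (hg : IsTameFun g) : IsTameFun fun x => f x + g x := by
  intro R hR
  obtain ⟨R₁, h₁, hle₁, hf₁⟩ := hf R hR
  obtain ⟨R₂, h₂, hle₂, hg₂⟩ := hg R₁ h₁
  exact ⟨R₂, h₂, hle₁.trans hle₂, R₂.add_mem (hle₂ hf₁) hg₂⟩

theorem mul (hf : IsTameFun f) (hg : IsTameFun g) : IsTameFun fun x => f x * g x := by
  intro R hR
  obtain ⟨R₁, h₁, hle₁, hf₁⟩ := hf R hR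
  obtain ⟨R₂, h₂, hle₂, hg₂⟩ := hg R₁ h₁
  exact ⟨R₂, h₂, hle₁.trans hle₂, R₂.mul_mem (hle₂ hf₁) hg₂⟩

theorem neg (hf : IsTameFun f) : IsTameFun fun x => -f x := by
  simpa using (const (-1)).mul hf

theorem sub (hf : IsTameFun f) (hg : IsTameFun g) : IsTameFun fun x => f x - g x := by
  simpa [sub_eq_add_neg] using hf.add hg.neg

theorem pow_two (hf : IsTameFun f) : IsTameFun fun x => f x ^ 2 := by
  simpa only [_root_.pow_two] using hf.mul hf

theorem isSemialgebraic_pos (hf : IsTameFun f) : IsSemialgebraic {x | 0 < f x} := by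
  obtain ⟨R, hR⟩ := exists_isTame ι
  obtain ⟨R', hR', -, hf'⟩ := hf R hR
  exact hR'.pos f hf'

theorem isSemialgebraic_lt (hf : IsTameFun f) (hg : IsTameFun g) :
    IsSemialgebraic {x | f x < g x} := by
  simpa using (hg.sub hf).isSemialgebraic_pos

theorem isSemialgebraic_le (hf : IsTameFun f) (hg : IsTameFun g) :
    IsSemialgebraic {x | f x ≤ g x} := by
  simpa [Set.compl_ofPred] using (hg.isSemialgebraic_lt hf).compl

theorem isSemialgebraic_eq (hf : IsTameFun f) (hg : IsTameFun g) :
    IsSemialgebraic {x | f x = g x} := by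
  simp only [le_antisymm_iff]
  exact (hf.isSemialgebraic_le hg).inter (hg.isSemialgebraic_le hf)

theorem piecewise {P : Set (ι → ℝ)} (hP : IsSemialgebraic P) (hf : IsTameFun f)
    (hg : IsTameFun g) (h₁ : ∀ x ∈ P, h x = f x) (h₂ : ∀ x ∉ P, h x = g x) : IsTameFun h := by
  intro R hR
  obtain ⟨R₁, hR₁, hle₁, hf₁⟩ := hf R hR
  obtain ⟨R₂, hR₂, hle₂, hg₂⟩ := hg R₁ hR₁
  obtain ⟨R₃, hR₃, hle₃, hh⟩ := hR₂.exists_piecewise hP (hle₂ hf₁) hg₂ h₁ h₂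
  exact ⟨R₃, hR₃, hle₁.trans (hle₂.trans hle₃), hh⟩

theorem sqrt (hf : IsTameFun f) (h0 : ∀ x, 0 ≤ f x) : IsTameFun fun x => √(f x) := by
  intro R hR
  obtain ⟨R₁, hR₁, hle₁, hf₁⟩ := hf R hR
  obtain ⟨R₂, hR₂, hle₂, hf₂⟩ := hR₁.exists_sqrt hf₁ h0
  exact ⟨R₂, hR₂, hle₁.trans hle₂, hf₂⟩

theorem inv (hf : IsTameFun f) : IsTameFun fun x => (f x)⁻¹ := by
  have hz := hf.isSemialgebraic_eq (const 0)
  -- Adding the indicator of the zero set gives a function without zeros, as `IsTame.exists_inv`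
  -- requires; on the zero set the inverse is 0 by convention.
  have hf' : IsTameFun fun x => f x + if f x = 0 then 1 else 0 :=
    hf.add (piecewise hz (const 1) (const 0) (fun x hx => if_pos hx) fun x hx => if_neg hx)
  refine piecewise (g := fun x => (f x + if f x = 0 then 1 else 0)⁻¹) hz (const 0) ?_
    (fun x (hx : f x = 0) => by simp [hx]) fun x (hx : ¬ f x = 0) => by simp [hx]
  intro R hR
  obtain ⟨R₁, hR₁, hle₁, hf₁⟩ := hf' R hR
  obtain ⟨R₂, hR₂, hle₂, hf₂⟩ := hR₁.exists_inv hf₁ fun x => by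
    by_cases hx : f x = 0 <;> simp [hx]
  exact ⟨R₂, hR₂, hle₁.trans hle₂, hf₂⟩

theorem div (hf : IsTameFun f) (hg : IsTameFun g) : IsTameFun fun x => f x / g x := by
  simpa [div_eq_mul_inv] using hf.mul hg.inv

theorem min (hf : IsTameFun f) (hg : IsTameFun g) : IsTameFun fun x => min (f x) (g x) :=
  piecewise (hf.isSemialgebraic_le hg) hf hg (fun _ hx => min_eq_left hx)
    fun _ hx => min_eq_right (not_le.1 hx).le

theorem abs (hf : IsTameFun f) : IsTameFun fun x => |f x| :=
  piecewise ((const 0).isSemialgebraic_le hf) hf hf.neg (fun _ hx => abs_of_nonneg hx)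
    fun _ hx => abs_of_neg (not_le.1 hx)

end IsTameFun

/-! ### The Euclidean norm and the disc -/

theorem planeNorm_nonneg (b : Fin 2 → ℝ) : 0 ≤ planeNorm b := Real.sqrt_nonneg _

theorem planeNorm_smul {s : ℝ} (hs : 0 ≤ s) (b : Fin 2 → ℝ) :
    planeNorm (s • b) = s * planeNorm b := by
  simp only [planeNorm, Pi.smul_apply, smul_eq_mul]
  rw [show (s * b 0) ^ 2 + (s * b 1) ^ 2 = s ^ 2 * (b 0 ^ 2 + b 1 ^ 2) by ring,
    Real.sqrt_mul (sq_nonneg s), Real.sqrt_sq hs]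

theorem planeNorm_eq_zero {b : Fin 2 → ℝ} : planeNorm b = 0 ↔ b = 0 := by
  rw [planeNorm, Real.sqrt_eq_zero (by positivity)]
  constructor
  · intro h
    ext i
    fin_cases i <;> simp <;> nlinarith [sq_nonneg (b 0), sq_nonneg (b 1)]
  · rintro rfl
    simp

@[simp] theorem planeNorm_zero : planeNorm 0 = 0 := planeNorm_eq_zero.2 rfl

theorem planeNorm_pos {b : Fin 2 → ℝ} : 0 < planeNorm b ↔ b ≠ 0 := by
  rw [(planeNorm_nonneg b).lt_iff_ne, ne_comm, Ne, planeNorm_eq_zero]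

theorem continuous_planeNorm : Continuous planeNorm := by
  unfold planeNorm
  fun_prop

theorem isCompact_closedDisc : IsCompact closedDisc := by
  refine Metric.isCompact_of_isClosed_isBounded
    (isClosed_le continuous_planeNorm continuous_const) ?_
  refine (Metric.isBounded_closedBall (x := (0 : Fin 2 → ℝ)) (r := 1)).subset fun b hb => ?_
  rw [mem_closedBall_zero_iff, pi_norm_le_iff_of_nonneg zero_le_one]
  have h : b 0 ^ 2 + b 1 ^ 2 ≤ 1 := by simpa [closedDisc, planeNorm] using hb
  intro i
  rw [Real.norm_eq_abs, ← sq_le_one_iff_abs_le_one]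
  fin_cases i
  · exact (le_add_of_nonneg_right (sq_nonneg _)).trans h
  · exact (le_add_of_nonneg_left (sq_nonneg _)).trans h

/-! ### The circle ℝ/2ℤ and its isometries -/

instance : Fact ((0 : ℝ) < 2) := ⟨two_pos⟩

theorem norm_addCircle_two_le_one (x : AddCircle (2 : ℝ)) : ‖x‖ ≤ 1 := by
  simpa using AddCircle.norm_le_half_period (p := (2 : ℝ)) (x := x) two_ne_zero

theorem norm_addCircle_two_eq_abs {w : ℝ} (h : |w| ≤ 1) : ‖(w : AddCircle (2 : ℝ))‖ = |w| := by
  rw [AddCircle.norm_coe_eq_abs_iff _ two_ne_zero]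
  simpa using h

theorem addCircle_coe_add_two (w : ℝ) : ((w + 2 : ℝ) : AddCircle (2 : ℝ)) = w :=
  AddCircle.coe_add_period _ _

theorem addCircle_coe_sub_two (w : ℝ) : ((w - 2 : ℝ) : AddCircle (2 : ℝ)) = w := by
  rw [← addCircle_coe_add_two, sub_add_cancel]

theorem exists_abs_add_eq_norm (w : ℝ) :
    ∃ n : ℤ, |w + 2 * n| = ‖(w : AddCircle (2 : ℝ))‖ :=
  ⟨-round ((2 : ℝ)⁻¹ * w), by rw [AddCircle.norm_eq]; congr 1; push_cast; ring⟩

theorem norm_addCircle_two_le_abs (w : ℝ) : ‖(w : AddCircle (2 : ℝ))‖ ≤ |w| := by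
  by_cases h : |w| ≤ 1
  · exact (norm_addCircle_two_eq_abs h).le
  · exact (norm_addCircle_two_le_one _).trans (not_le.1 h).le

/-- On [-3, 3] a nearest even integer is -2, 0 or 2. This range suffices later: two angles in [0, 2)
differ by less than 2, and the shear adds at most 1. -/
theorem norm_addCircle_two_eq_min {w : ℝ} (h : |w| ≤ 3) :
    ‖(w : AddCircle (2 : ℝ))‖ = min |w| (min |w + 2| |w - 2|) := by
  apply le_antisymm
  · refine le_min (norm_addCircle_two_le_abs w) (le_min ?_ ?_)
    · rw [← addCircle_coe_add_two]
      exact norm_addCircle_two_le_abs _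
    · rw [← addCircle_coe_sub_two]
      exact norm_addCircle_two_le_abs _
  · obtain ⟨h1, h2⟩ := abs_le.1 h
    rcases le_total w (-1) with h3 | h3
    · rw [← addCircle_coe_add_two, norm_addCircle_two_eq_abs (abs_le.2 ⟨by linarith, by linarith⟩)]
      exact (min_le_right _ _).trans (min_le_left _ _)
    rcases le_total w 1 with h4 | h4
    · rw [norm_addCircle_two_eq_abs (abs_le.2 ⟨by linarith, by linarith⟩)]
      exact min_le_left _ _
    · rw [← addCircle_coe_sub_two, norm_addCircle_two_eq_abs (abs_le.2 ⟨by linarith, by linarith⟩)]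
      exact (min_le_right _ _).trans (min_le_right _ _)

theorem addCircle_exists_rep (x : AddCircle (2 : ℝ)) : ∃ w : ℝ, (w : AddCircle (2 : ℝ)) = x ∧
    -1 < w ∧ w ≤ 1 := by
  obtain ⟨⟨w, hw⟩, rfl⟩ := (AddCircle.equivIoc (2 : ℝ) (-1)).symm.surjective x
  exact ⟨w, rfl, hw.1, by linarith [hw.2]⟩

theorem addCircle_eq_or_eq_neg_of_norm_eq {x y : AddCircle (2 : ℝ)} (h : ‖x‖ = ‖y‖) :
    x = y ∨ x = -y := by
  obtain ⟨u, rfl, hu⟩ := addCircle_exists_rep x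
  obtain ⟨v, rfl, hv⟩ := addCircle_exists_rep y
  rw [norm_addCircle_two_eq_abs (abs_le.2 ⟨hu.1.le, hu.2⟩),
    norm_addCircle_two_eq_abs (abs_le.2 ⟨hv.1.le, hv.2⟩), abs_eq_abs] at h
  rcases h with rfl | rfl
  · exact Or.inl rfl
  · exact Or.inr (AddCircle.coe_neg _)

/-- A point of `ℝ/2ℤ` is determined by its distances to `0` and `1/2`. -/
theorem addCircle_eq_of_norm_eq {x y : AddCircle (2 : ℝ)} (h : ‖x‖ = ‖y‖)
    (h' : ‖x - ((1 / 2 : ℝ) : AddCircle (2 : ℝ))‖ = ‖y - ((1 / 2 : ℝ) : AddCircle (2 : ℝ))‖) :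
    x = y := by
  rcases addCircle_eq_or_eq_neg_of_norm_eq h with h | rfl
  · exact h
  obtain ⟨v, rfl, hv⟩ := addCircle_exists_rep y
  rw [← AddCircle.coe_neg, ← AddCircle.coe_sub, ← AddCircle.coe_sub,
    norm_addCircle_two_eq_min (abs_le.2 ⟨by linarith, by linarith⟩),
    norm_addCircle_two_eq_min (abs_le.2 ⟨by linarith, by linarith⟩)] at h'
  -- The points v and -v are equidistant from 1/2 only at the two fixed points of the reflection.
  have : v = 0 ∨ v = 1 := by
    grind
  rcases this with rfl | rfl
  · simp
  · rw [← AddCircle.coe_neg, ← addCircle_coe_add_two]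
    norm_num

/-- Distance-preserving self-maps of `ℝ/2ℤ` are compositions of rotations and reflections. -/
theorem addCircle_isometry_classification {h : ℝ → ℝ}
    (hh : ∀ u v, ‖((h u - h v : ℝ) : AddCircle (2 : ℝ))‖ = ‖((u - v : ℝ) : AddCircle (2 : ℝ))‖) :
    ∃ c ε : ℝ, (ε = 1 ∨ ε = -1) ∧ ∀ u, (h u : AddCircle (2 : ℝ)) = (c + ε * u : ℝ) := by
  have h0 : ∀ u, ‖((h u - h 0 : ℝ) : AddCircle (2 : ℝ))‖ = ‖(u : AddCircle (2 : ℝ))‖ := fun u => by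
    rw [hh, sub_zero]
  have h1 : ∀ u, ‖((h u - h 0 : ℝ) : AddCircle (2 : ℝ)) - (h (1 / 2) - h 0 : ℝ)‖
      = ‖(u : AddCircle (2 : ℝ)) - ((1 / 2 : ℝ) : AddCircle (2 : ℝ))‖ := fun u => by
    rw [← AddCircle.coe_sub, sub_sub_sub_cancel_right, hh, AddCircle.coe_sub]
  -- Relative to the image of 0, the image of 1/2 is ±1/2. This sign fixes the orientation, and the
  -- distances to these two images determine every other image.
  rcases addCircle_eq_or_eq_neg_of_norm_eq (h0 (1 / 2)) with h2 | h2
  · refine ⟨h 0, 1, Or.inl rfl, fun u => ?_⟩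
    have := addCircle_eq_of_norm_eq (h0 u) (h2 ▸ h1 u)
    rw [AddCircle.coe_sub, sub_eq_iff_eq_add'] at this
    rw [this, one_mul, AddCircle.coe_add]
  · refine ⟨h 0, -1, Or.inr rfl, fun u => ?_⟩
    have := addCircle_eq_of_norm_eq (x := -((h u - h 0 : ℝ) : AddCircle (2 : ℝ)))
      ((norm_neg _).trans (h0 u)) (by rw [← h1 u, h2, ← norm_neg]; congr 1; abel)
    rw [neg_eq_iff_eq_neg, AddCircle.coe_sub, sub_eq_iff_eq_add'] at this
    rw [this, neg_one_mul, AddCircle.coe_add, AddCircle.coe_neg]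

/-! ### Parametrization of the circle and the inverse angle -/

/-- The parametrization of the boundary of the diamond `|x| + |y| = 1` by `ℝ/2ℤ`. -/
noncomputable def diamondParam (x : AddCircle (2 : ℝ)) : Fin 2 → ℝ :=
  ![1 - 2 * ‖x‖, 1 - 2 * ‖x - ((1 / 2 : ℝ) : AddCircle (2 : ℝ))‖]

theorem abs_diamondParam (x : AddCircle (2 : ℝ)) :
    |diamondParam x 0| + |diamondParam x 1| = 1 := by
  obtain ⟨v, rfl, hv⟩ := addCircle_exists_rep x
  simp only [diamondParam, ← AddCircle.coe_sub, Matrix.cons_val_zero, Matrix.cons_val_one]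
  rw [norm_addCircle_two_eq_min (abs_le.2 ⟨by linarith, by linarith⟩),
    norm_addCircle_two_eq_min (abs_le.2 ⟨by linarith, by linarith⟩)]
  grind

theorem diamondParam_injective : Function.Injective diamondParam := by
  intro x y h
  have h0 := congrFun h 0
  have h1 := congrFun h 1
  simp only [diamondParam, Matrix.cons_val_zero, Matrix.cons_val_one] at h0 h1
  exact addCircle_eq_of_norm_eq (by linarith) (by linarith)

theorem continuous_diamondParam : Continuous diamondParam := by
  refine continuous_pi fun i => ?_
  fin_cases i <;> simp [diamondParam] <;> fun_prop

theorem planeNorm_diamondParam_pos (x : AddCircle (2 : ℝ)) : 0 < planeNorm (diamondParam x) := by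
  rw [planeNorm_pos]
  intro h
  simpa [h] using abs_diamondParam x

/-- The parametrization of the unit circle by `ℝ/2ℤ`, radially projected from the diamond. -/
noncomputable def circleParam (x : AddCircle (2 : ℝ)) : Fin 2 → ℝ :=
  (planeNorm (diamondParam x))⁻¹ • diamondParam x

theorem planeNorm_circleParam (x : AddCircle (2 : ℝ)) : planeNorm (circleParam x) = 1 := by
  have h := planeNorm_diamondParam_pos x
  rw [circleParam, planeNorm_smul (inv_nonneg.2 h.le), inv_mul_cancel₀ h.ne']

theorem continuous_circleParam : Continuous circleParam :=
  ((continuous_planeNorm.comp continuous_diamondParam).inv₀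
    fun x => (planeNorm_diamondParam_pos x).ne').smul continuous_diamondParam

/-- Rescaling to ℓ¹ norm 1 undoes the radial projection, so injectivity passes from the diamond to
the circle. -/
theorem diamondParam_eq (x : AddCircle (2 : ℝ)) :
    diamondParam x = (|circleParam x 0| + |circleParam x 1|)⁻¹ • circleParam x := by
  have h := planeNorm_diamondParam_pos x
  have h' := abs_diamondParam x
  simp only [circleParam, Pi.smul_apply, smul_eq_mul, abs_mul, abs_of_pos (inv_pos.2 h), smul_smul,
    ← mul_add, h', mul_one, inv_inv, mul_inv_cancel₀ h.ne', one_smul]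

theorem circleParam_injective : Function.Injective circleParam := fun x y h =>
  diamondParam_injective (by rw [diamondParam_eq, diamondParam_eq, h])

/-- The angular coordinate in `[0, 2)` of a nonzero point of the plane. -/
noncomputable def angle (b : Fin 2 → ℝ) : ℝ :=
  if 0 ≤ b 1 then (1 - b 0 / (|b 0| + |b 1|)) / 2 else (3 + b 0 / (|b 0| + |b 1|)) / 2

theorem angle_mem_Ico (b : Fin 2 → ℝ) : angle b ∈ Set.Ico 0 2 := by
  have h : |b 0 / (|b 0| + |b 1|)| ≤ 1 := by
    rw [abs_div, abs_of_nonneg (by positivity : 0 ≤ |b 0| + |b 1|)]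
    exact div_le_one_of_le₀ (le_add_of_nonneg_right (abs_nonneg _)) (by positivity)
  obtain ⟨h1, h2⟩ := abs_le.1 h
  unfold angle
  split_ifs with hb
  · exact ⟨by linarith, by linarith⟩
  · refine ⟨by linarith, ?_⟩
    have : b 0 / (|b 0| + |b 1|) < 1 := by
      have hb' : 0 < |b 1| := abs_pos.2 (by intro h; simp [h] at hb)
      rw [div_lt_one (by positivity)]
      linarith [le_abs_self (b 0)]
    linarith

/-- The upper half of the diamond is the image of [0, 1], where ‖w‖ = w, and the lower half that of
(1, 2), where ‖w‖ = 2 - w. -/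
theorem diamondParam_ite {x y : ℝ} (h : |x| + |y| = 1) :
    diamondParam ((if 0 ≤ y then (1 - x) / 2 else (3 + x) / 2 : ℝ) : AddCircle (2 : ℝ)) =
      ![x, y] := by
  have hx : |x| ≤ 1 := by linarith [abs_nonneg y]
  obtain ⟨h1, h2⟩ := abs_le.1 hx
  split_ifs with hy
  · rw [abs_of_nonneg hy] at h
    have e1 : ‖(((1 - x) / 2 : ℝ) : AddCircle (2 : ℝ))‖ = (1 - x) / 2 := by
      rw [norm_addCircle_two_eq_abs (abs_le.2 ⟨by linarith, by linarith⟩),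
        abs_of_nonneg (by linarith)]
    have e2 : ‖(((1 - x) / 2 - 1 / 2 : ℝ) : AddCircle (2 : ℝ))‖ = |x| / 2 := by
      rw [show (1 - x) / 2 - 1 / 2 = -x / 2 by ring, norm_addCircle_two_eq_abs, abs_div, abs_neg,
        abs_two]
      rw [abs_div, abs_neg, abs_two]
      linarith
    rw [diamondParam, ← AddCircle.coe_sub, e1, e2]
    congr 1
    · ring
    · congr 1
      linarith
  · rw [abs_of_neg (not_le.1 hy)] at h
    have e1 : ‖(((3 + x) / 2 : ℝ) : AddCircle (2 : ℝ))‖ = (1 - x) / 2 := by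
      rw [← addCircle_coe_sub_two, norm_addCircle_two_eq_abs (abs_le.2 ⟨by linarith, by linarith⟩),
        abs_of_nonpos (by linarith)]
      ring
    have e2 : ‖(((3 + x) / 2 - 1 / 2 : ℝ) : AddCircle (2 : ℝ))‖ = 1 - |x| / 2 := by
      rcases le_total 0 x with h0 | h0
      · rw [← addCircle_coe_sub_two, abs_of_nonneg h0,
          norm_addCircle_two_eq_abs (abs_le.2 ⟨by linarith, by linarith⟩),
          abs_of_nonpos (by linarith)]
        ring
      · rw [abs_of_nonpos h0, norm_addCircle_two_eq_abs (abs_le.2 ⟨by linarith, by linarith⟩),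
          abs_of_nonneg (by linarith)]
        ring
    rw [diamondParam, ← AddCircle.coe_sub, e1, e2]
    congr 1
    · ring
    · congr 1
      linarith

theorem diamondParam_angle {b : Fin 2 → ℝ} (hb : b ≠ 0) :
    diamondParam (angle b) = (|b 0| + |b 1|)⁻¹ • b := by
  have hpos : 0 < |b 0| + |b 1| := by
    refine (by positivity : 0 ≤ |b 0| + |b 1|).lt_of_ne' fun h => hb ?_
    rw [add_eq_zero_iff_of_nonneg (abs_nonneg _) (abs_nonneg _), abs_eq_zero, abs_eq_zero] at h
    ext i
    fin_cases i
    exacts [h.1, h.2]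
  obtain ⟨x, hx⟩ : ∃ x, x = b 0 / (|b 0| + |b 1|) := ⟨_, rfl⟩
  obtain ⟨y, hy⟩ : ∃ y, y = b 1 / (|b 0| + |b 1|) := ⟨_, rfl⟩
  have hxy : |x| + |y| = 1 := by
    rw [hx, hy, abs_div, abs_div, abs_of_pos hpos, ← add_div, div_self hpos.ne']
  have hy0 : 0 ≤ b 1 ↔ 0 ≤ y := by
    rw [hy, le_div_iff₀ hpos, zero_mul]
  have hang : angle b = if 0 ≤ y then (1 - x) / 2 else (3 + x) / 2 := by
    simp only [angle, hy0, hx]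
  have hb' : (|b 0| + |b 1|)⁻¹ • b = ![x, y] := by
    ext i
    fin_cases i <;> simp [hx, hy, div_eq_inv_mul]
  rw [hb', hang, diamondParam_ite hxy]

theorem circleParam_angle {b : Fin 2 → ℝ} (hb : b ≠ 0) :
    circleParam (angle b) = (planeNorm b)⁻¹ • b := by
  have h : 0 < (|b 0| + |b 1|)⁻¹ := by
    have h' := planeNorm_diamondParam_pos (angle b)
    rw [diamondParam_angle hb, planeNorm_smul (by positivity)] at h'
    exact pos_of_mul_pos_left h' (planeNorm_nonneg b)
  rw [circleParam, diamondParam_angle hb, planeNorm_smul h.le, smul_smul, mul_inv, mul_right_comm,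
    inv_mul_cancel₀ h.ne', one_mul]

theorem planeNorm_smul_circleParam_angle {b : Fin 2 → ℝ} (hb : b ≠ 0) :
    planeNorm b • circleParam (angle b) = b := by
  rw [circleParam_angle hb, smul_inv_smul₀ (planeNorm_pos.2 hb).ne']

theorem planeNorm_smul_circleParam {s : ℝ} (hs : 0 ≤ s) (x : AddCircle (2 : ℝ)) :
    planeNorm (s • circleParam x) = s := by
  rw [planeNorm_smul hs, planeNorm_circleParam, mul_one]

theorem smul_circleParam_ne_zero {s : ℝ} (hs : 0 < s) (x : AddCircle (2 : ℝ)) :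
    s • circleParam x ≠ 0 := by
  rw [← planeNorm_pos, planeNorm_smul_circleParam hs.le]
  exact hs

theorem angle_smul_circleParam {s : ℝ} (hs : 0 < s) (x : AddCircle (2 : ℝ)) :
    (angle (s • circleParam x) : AddCircle (2 : ℝ)) = x := by
  apply circleParam_injective
  rw [circleParam_angle (smul_circleParam_ne_zero hs x), planeNorm_smul_circleParam hs.le,
    inv_smul_smul₀ hs.ne']

/-- The real angle jumps, but its class does not: `circleParam` embeds the compact circle, and
composing with it gives b / |b|. -/
theorem continuousOn_angle :
    ContinuousOn (fun b : Fin 2 → ℝ => (angle b : AddCircle (2 : ℝ))) {b | b ≠ 0} := by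
  have hind := (continuous_circleParam.isClosedEmbedding circleParam_injective).isInducing
  rw [hind.continuousOn_iff]
  refine ContinuousOn.congr (f := fun b => (planeNorm b)⁻¹ • b) ?_ fun b hb => circleParam_angle hb
  exact (continuous_planeNorm.continuousOn.inv₀ fun b hb => (planeNorm_pos.2 hb).ne').smul
    continuousOn_id

/-! ### The metric on the strip -/

/-- The triangle inequality survives the shortcut through the added point, provided that a change of
radius never exceeds the distance δ; the mixed cases use this bound. -/
theorem min_half_add_le {s t r δ₁ δ₂ δ₃ : ℝ} (ht : 0 ≤ t) (h : δ₃ ≤ δ₁ + δ₂)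
    (h₁ : |s - t| ≤ δ₁) (h₂ : |t - r| ≤ δ₂) :
    min ((s + r) / 2) δ₃ ≤ min ((s + t) / 2) δ₁ + min ((t + r) / 2) δ₂ := by
  have h₁' := abs_le.1 h₁
  have h₂' := abs_le.1 h₂
  rcases min_cases ((s + t) / 2) δ₁ with ⟨e, _⟩ | ⟨e, _⟩ <;>
  rcases min_cases ((t + r) / 2) δ₂ with ⟨e', _⟩ | ⟨e', _⟩ <;> rw [e, e']
  · exact (min_le_left _ _).trans (by linarith)
  · exact (min_le_left _ _).trans (by linarith [abs_nonneg (t - r)])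
  · exact (min_le_left _ _).trans (by linarith [abs_nonneg (s - t)])
  · exact (min_le_right _ _).trans h

theorem abs_sub_le_abs_inv_sub_inv {s t : ℝ} (hs : 0 < s) (hs' : s ≤ 1) (ht : 0 < t)
    (ht' : t ≤ 1) : |s - t| ≤ |s⁻¹ - t⁻¹| := by
  rw [inv_sub_inv hs.ne' ht.ne', abs_div, abs_of_pos (mul_pos hs ht), abs_sub_comm t,
    le_div_iff₀ (mul_pos hs ht)]
  exact mul_le_of_le_one_right (abs_nonneg _) (mul_le_one₀ hs' ht.le ht')

/-- The metric on the strip: the `ℓ¹` distance in the coordinates `(1 / x₁, x₂)`, cut off by the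
passage through an added point at distance `x₁ / 2`; the fibre coordinate is sheared by `κ / x₁`. -/
noncomputable def stripDist (κ : ℝ) (x y : Fin 2 → ℝ) : ℝ :=
  min ((x 0 + y 0) / 2) (|(x 0)⁻¹ - (y 0)⁻¹| + |x 1 - y 1 + κ * ((x 0)⁻¹ - (y 0)⁻¹)|)

theorem isSemialgebraicMetricSpace_strip : IsSemialgebraicMetricSpace strip (stripDist 0) where
  semialgebraic_carrier :=
    ((IsTameFun.const 0).isSemialgebraic_lt (.coord 0)).inter
      ((IsTameFun.coord 0).isSemialgebraic_le (.const 1))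
  eq_zero_iff := by
    intro x hx y hy
    have hs : 0 < (x 0 + y 0) / 2 := half_pos (add_pos hx.1 hy.1)
    constructor
    · intro h
      rcases min_choice ((x 0 + y 0) / 2)
        (|(x 0)⁻¹ - (y 0)⁻¹| + |x 1 - y 1 + 0 * ((x 0)⁻¹ - (y 0)⁻¹)|) with h' | h'
      · exact absurd (h'.symm.trans h) hs.ne'
      · have h0 := h'.symm.trans h
        rw [add_eq_zero_iff_of_nonneg (abs_nonneg _) (abs_nonneg _), abs_eq_zero, abs_eq_zero,
          zero_mul, add_zero, sub_eq_zero, sub_eq_zero, inv_inj] at h0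
        ext i
        fin_cases i
        exacts [h0.1, h0.2]
    · rintro rfl
      simp [stripDist, hx.1.le]
  symm := by
    intro x _ y _
    simp only [stripDist, zero_mul, add_zero]
    rw [add_comm (x 0), abs_sub_comm (x 0)⁻¹, abs_sub_comm (x 1)]
  triangle := by
    intro x hx y hy z hz
    simp only [stripDist, zero_mul, add_zero]
    refine min_half_add_le hy.1.le ?_
      ((abs_sub_le_abs_inv_sub_inv hx.1 hx.2 hy.1 hy.2).trans
        (le_add_of_nonneg_right (abs_nonneg _)))
      ((abs_sub_le_abs_inv_sub_inv hy.1 hy.2 hz.1 hz.2).trans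
        (le_add_of_nonneg_right (abs_nonneg _)))
    linarith [abs_sub_le (x 0)⁻¹ (y 0)⁻¹ (z 0)⁻¹, abs_sub_le (x 1) (y 1) (z 1)]
  continuousOn := by
    simp only [stripDist, zero_mul, add_zero]
    have h1 : ContinuousOn (fun p : (Fin 2 → ℝ) × (Fin 2 → ℝ) => (p.1 0)⁻¹) (strip ×ˢ strip) :=
      ContinuousOn.inv₀ (by fun_prop) fun p hp => hp.1.1.ne'
    have h2 : ContinuousOn (fun p : (Fin 2 → ℝ) × (Fin 2 → ℝ) => (p.2 0)⁻¹) (strip ×ˢ strip) :=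
      ContinuousOn.inv₀ (by fun_prop) fun p hp => hp.2.1.ne'
    exact ContinuousOn.inf (by fun_prop) ((h1.sub h2).abs.add (by fun_prop))
  semialgebraic_dist := by
    have hs (i : (Fin 2 ⊕ Fin 2) ⊕ Fin 1) : IsSemialgebraic
        {z : (Fin 2 ⊕ Fin 2) ⊕ Fin 1 → ℝ | 0 < z i ∧ z i ≤ 1} :=
      ((IsTameFun.const 0).isSemialgebraic_lt (.coord i)).inter
        ((IsTameFun.coord i).isSemialgebraic_le (.const 1))
    refine (hs (.inl (.inl 0))).inter ((hs (.inl (.inr 0))).inter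
      ((IsTameFun.coord (Sum.inr 0)).isSemialgebraic_eq ?_))
    have hc (i) : IsTameFun fun z : (Fin 2 ⊕ Fin 2) ⊕ Fin 1 → ℝ => z i := .coord i
    exact (((hc _).add (hc _)).div (.const 2)).min
      (((hc _).inv.sub (hc _).inv).abs.add (((hc _).sub (hc _)).add
        ((IsTameFun.const 0).mul ((hc _).inv.sub (hc _).inv))).abs)

theorem stripDist_translate (κ : ℝ) (x y : Fin 2 → ℝ) (a : ℝ) :
    stripDist κ ![x 0, x 1 + a] ![y 0, y 1 + a] = stripDist κ x y := by
  simp [stripDist]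

/-! ### The covering and the twist -/

/-- The periodic parametrization of the circle. -/
noncomputable def circleCover (t : ℝ) : Fin 2 → ℝ := circleParam (t : AddCircle (2 : ℝ))

/-- The twist function `t ↦ 1 / t - 1`. -/
noncomputable def twist (t : ℝ) : ℝ := t⁻¹ - 1

/-- The constant -1 of the twist cancels in differences, leaving the shear by 1/s - 1/t. -/
theorem twistedDist_stripDist : twistedDist twist (stripDist 0) = stripDist 1 := by
  ext x y
  simp only [twistedDist, stripDist, twist, Matrix.cons_val_zero, Matrix.cons_val_one]
  congr 3
  ring

theorem isTwistFunction_twist : IsTwistFunction twist where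
  semialgebraic :=
    (((IsTameFun.const 0).isSemialgebraic_lt (.coord 0)).inter
      ((IsTameFun.coord 0).isSemialgebraic_le (.const 1))).inter
      ((IsTameFun.coord 1).isSemialgebraic_eq ((IsTameFun.coord 0).inv.sub (.const 1)))
  continuousOn := (continuousOn_id.inv₀ fun _ ht => ht.1.ne').sub continuousOn_const
  strictAntiOn := fun s hs _ _ hst => sub_lt_sub_right (inv_strictAnti₀ hs.1 hst) 1
  map_one := by simp [twist]
  tendsto := tendsto_atTop_add_const_right _ (-1) tendsto_inv_nhdsGT_zero

theorem IsTameFun.planeNorm {ι : Type} {f : (ι → ℝ) → Fin 2 → ℝ}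
    (hf : ∀ i, IsTameFun fun z => f z i) : IsTameFun fun z => planeNorm (f z) :=
  ((hf 0).pow_two.add (hf 1).pow_two).sqrt fun _ => by positivity

theorem IsTameFun.angle {ι : Type} {f : (ι → ℝ) → Fin 2 → ℝ}
    (hf : ∀ i, IsTameFun fun z => f z i) : IsTameFun fun z => angle (f z) := by
  have h := (hf 0).div ((hf 0).abs.add (hf 1).abs)
  exact .piecewise ((IsTameFun.const 0).isSemialgebraic_le (hf 1))
    (((IsTameFun.const 1).sub h).div (.const 2)) (((IsTameFun.const 3).add h).div (.const 2))
    (fun _ hz => if_pos hz) fun _ hz => if_neg hz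

/-- A semialgebraic expression for the norm of `ℝ/2ℤ` on `[-3, 3]`. -/
noncomputable def foldedAbs (w : ℝ) : ℝ := min |w| (min |w + 2| |w - 2|)

theorem IsTameFun.foldedAbs {ι : Type} {f : (ι → ℝ) → ℝ} (hf : IsTameFun f) :
    IsTameFun fun z => foldedAbs (f z) :=
  hf.abs.min ((hf.add (.const 2)).abs.min (hf.sub (.const 2)).abs)

theorem isPeriodicSemialgebraicCovering_circleCover :
    IsPeriodicSemialgebraicCovering circleCover where
  continuous := continuous_circleParam.comp (AddCircle.continuous_mk' 2)
  periodic := fun t => congrArg circleParam (addCircle_coe_add_two t)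
  bijOn := by
    refine ⟨fun t _ => planeNorm_circleParam _, fun s hs t ht h => ?_, fun b hb => ?_⟩
    · have h' := circleParam_injective h
      rwa [AddCircle.coe_eq_coe_iff_of_mem_Ico (a := 0) (by simpa using hs) (by simpa using ht)]
        at h'
    · have hb0 : b ≠ 0 := by
        rintro rfl
        simp [unitCircle] at hb
      refine ⟨angle b, angle_mem_Ico b, ?_⟩
      have hb1 : planeNorm b = 1 := hb
      rw [circleCover, circleParam_angle hb0, hb1, inv_one, one_smul]
  mapsTo := fun t => planeNorm_circleParam _
  semialgebraic := by
    intro n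
    have hc (i) : IsTameFun fun z : Fin 2 ⊕ Fin 2 → ℝ => z i := .coord i
    have hv : IsTameFun fun z : Fin 2 ⊕ Fin 2 → ℝ => z (.inl 1) - 2 * n := (hc _).sub (.const _)
    have hX := (IsTameFun.const 1).sub ((IsTameFun.const 2).mul hv.foldedAbs)
    have hY := (IsTameFun.const 1).sub
      ((IsTameFun.const 2).mul (hv.sub (.const (1 / 2))).foldedAbs)
    have hN := (IsTameFun.planeNorm (f := fun z : Fin 2 ⊕ Fin 2 → ℝ =>
      ![1 - 2 * foldedAbs (z (.inl 1) - 2 * n),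
        1 - 2 * foldedAbs (z (.inl 1) - 2 * n - 1 / 2)]) fun i => by
          fin_cases i
          exacts [hX, hY]).inv
    have hdom : IsSemialgebraic {z : Fin 2 ⊕ Fin 2 → ℝ |
        z ∘ Sum.inl ∈ {x | x ∈ strip ∧ 2 * (n : ℝ) ≤ x 1 ∧ x 1 ≤ 2 * (n : ℝ) + 2}} :=
      (((IsTameFun.const 0).isSemialgebraic_lt (hc _)).inter
        ((hc _).isSemialgebraic_le (.const 1))).inter
        (((IsTameFun.const _).isSemialgebraic_le (hc _)).inter
          ((hc _).isSemialgebraic_le (.const _)))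
    have h := hdom.inter (((hc (.inr 0)).isSemialgebraic_eq ((hc (.inl 0)).mul (hN.mul hX))).inter
      ((hc (.inr 1)).isSemialgebraic_eq ((hc (.inl 0)).mul (hN.mul hY))))
    unfold IsSemialgebraicMapOn
    convert h using 1
    ext z
    refine and_congr_right fun hz => ?_
    have hz1 : 2 * (n : ℝ) ≤ z (.inl 1) := hz.2.1
    have hz2 : z (.inl 1) ≤ 2 * (n : ℝ) + 2 := hz.2.2
    -- Subtracting the period 2n moves the angle to [0, 2], so both norms in `diamondParam` are
    -- evaluated within [-3, 3].
    have hcoe : ((z (.inl 1) : ℝ) : AddCircle (2 : ℝ)) = (z (.inl 1) - 2 * n : ℝ) := by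
      rw [AddCircle.coe_sub, eq_comm, sub_eq_self, AddCircle.coe_eq_zero_iff]
      exact ⟨n, by simp [mul_comm]⟩
    have hd : diamondParam (z (.inl 1) : ℝ) = ![1 - 2 * foldedAbs (z (.inl 1) - 2 * n),
        1 - 2 * foldedAbs (z (.inl 1) - 2 * n - 1 / 2)] := by
      rw [diamondParam, hcoe, ← AddCircle.coe_sub,
        norm_addCircle_two_eq_min (abs_le.2 ⟨by linarith, by linarith⟩),
        norm_addCircle_two_eq_min (abs_le.2 ⟨by linarith, by linarith⟩)]
      rfl
    simp only [polarMap, circleCover, circleParam, Function.comp_apply, hd, funext_iff,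
      Fin.forall_fin_two]
    rfl

/-! ### The metrics on the disc -/

/-- The metrics on the disc: `stripDist κ` pushed down along the covering. -/
noncomputable def discDist (κ : ℝ) (b b' : Fin 2 → ℝ) : ℝ :=
  if b = 0 ∨ b' = 0 then (planeNorm b + planeNorm b') / 2
  else min ((planeNorm b + planeNorm b') / 2) (|(planeNorm b)⁻¹ - (planeNorm b')⁻¹| +
    ‖((angle b - angle b' + κ * ((planeNorm b)⁻¹ - (planeNorm b')⁻¹) : ℝ) : AddCircle (2 : ℝ))‖)

theorem discDist_of_eq_zero {κ : ℝ} {b b' : Fin 2 → ℝ} (h : b = 0 ∨ b' = 0) :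
    discDist κ b b' = (planeNorm b + planeNorm b') / 2 := if_pos h

theorem discDist_smul (κ : ℝ) {s t : ℝ} (hs : 0 < s) (ht : 0 < t) (x y : AddCircle (2 : ℝ)) :
    discDist κ (s • circleParam x) (t • circleParam y) = min ((s + t) / 2)
      (|s⁻¹ - t⁻¹| + ‖x - y + (κ * (s⁻¹ - t⁻¹) : ℝ)‖) := by
  rw [discDist, if_neg (not_or.2 ⟨smul_circleParam_ne_zero hs x, smul_circleParam_ne_zero ht y⟩),
    planeNorm_smul_circleParam hs.le, planeNorm_smul_circleParam ht.le, AddCircle.coe_add,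
    AddCircle.coe_sub, angle_smul_circleParam hs, angle_smul_circleParam ht]

theorem exists_eq_smul_circleParam {b : Fin 2 → ℝ} (hb : b ∈ closedDisc) (h0 : b ≠ 0) :
    ∃ (s : ℝ) (x : AddCircle (2 : ℝ)), 0 < s ∧ s ≤ 1 ∧ b = s • circleParam x :=
  ⟨planeNorm b, angle b, planeNorm_pos.2 h0, hb, (planeNorm_smul_circleParam_angle h0).symm⟩

theorem smul_circleParam_mem {s : ℝ} (hs : 0 ≤ s) (hs' : s ≤ 1) (x : AddCircle (2 : ℝ)) :
    s • circleParam x ∈ closedDisc := by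
  rwa [closedDisc, Set.mem_ofPred_eq, planeNorm_smul_circleParam hs]

theorem zero_mem_closedDisc : (0 : Fin 2 → ℝ) ∈ closedDisc := by simp [closedDisc]

theorem discDist_le (κ : ℝ) (b b' : Fin 2 → ℝ) :
    discDist κ b b' ≤ (planeNorm b + planeNorm b') / 2 := by
  unfold discDist
  split_ifs
  exacts [le_rfl, min_le_left _ _]

/-- Lifts of a point differ by even translations, so minimizing over them turns the absolute value
into the norm of ℝ/2ℤ. The nearest even translate attains the infimum. -/
theorem isPushedDown_discDist (κ : ℝ) : IsPushedDown circleCover (stripDist κ) (discDist κ) := by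
  refine ⟨fun b hb b' hb' h0 h0' => IsLeast.isGLB ⟨?_, ?_⟩, fun b _ => ?_⟩
  · obtain ⟨n, hn⟩ := exists_abs_add_eq_norm
      (angle b - angle b' + κ * ((planeNorm b)⁻¹ - (planeNorm b')⁻¹))
    refine ⟨![planeNorm b, angle b + 2 * n], ⟨planeNorm_pos.2 h0, hb⟩, ![planeNorm b', angle b'],
      ⟨planeNorm_pos.2 h0', hb'⟩, ?_, planeNorm_smul_circleParam_angle h0', ?_⟩
    · have : ((angle b + 2 * n : ℝ) : AddCircle (2 : ℝ)) = angle b := by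
        rw [AddCircle.coe_add, add_eq_left, AddCircle.coe_eq_zero_iff]
        exact ⟨n, by simp [mul_comm]⟩
      simp only [polarMap, circleCover, Matrix.cons_val_zero, Matrix.cons_val_one, this,
        planeNorm_smul_circleParam_angle h0]
    · rw [discDist, if_neg (not_or.2 ⟨h0, h0'⟩), ← hn]
      simp only [stripDist, Matrix.cons_val_zero, Matrix.cons_val_one]
      congr 3
      ring
  · rintro _ ⟨x, hx, x', hx', rfl, rfl, rfl⟩
    simp only [polarMap, circleCover]
    rw [discDist_smul κ hx.1 hx'.1, ← AddCircle.coe_sub, ← AddCircle.coe_add]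
    exact min_le_min le_rfl (add_le_add le_rfl (norm_addCircle_two_le_abs _))
  · simp [discDist]

theorem discDist_self (κ : ℝ) (b : Fin 2 → ℝ) : discDist κ b b = 0 := by
  by_cases h : b = 0
  · simp [discDist, h]
  · simp [discDist, h, planeNorm_nonneg]

theorem discDist_comm (κ : ℝ) (b b' : Fin 2 → ℝ) : discDist κ b b' = discDist κ b' b := by
  simp only [discDist, or_comm (a := b = 0), add_comm (planeNorm b),
    abs_sub_comm (planeNorm b)⁻¹]
  congr 3
  rw [← norm_neg, ← AddCircle.coe_neg]
  congr 2
  ring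

theorem discDist_eq_zero_iff (κ : ℝ) {b b' : Fin 2 → ℝ} (hb : b ∈ closedDisc)
    (hb' : b' ∈ closedDisc) : discDist κ b b' = 0 ↔ b = b' := by
  refine ⟨fun h => ?_, fun h => h ▸ discDist_self κ b⟩
  by_cases h0 : b = 0 ∨ b' = 0
  · rw [discDist_of_eq_zero h0, div_eq_zero_iff, or_iff_left two_ne_zero,
      add_eq_zero_iff_of_nonneg (planeNorm_nonneg _) (planeNorm_nonneg _), planeNorm_eq_zero,
      planeNorm_eq_zero] at h
    rw [h.1, h.2]
  obtain ⟨s, x, hs, -, rfl⟩ := exists_eq_smul_circleParam hb fun h => h0 (Or.inl h)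
  obtain ⟨t, y, ht, -, rfl⟩ := exists_eq_smul_circleParam hb' fun h => h0 (Or.inr h)
  rw [discDist_smul κ hs ht] at h
  have h' : |s⁻¹ - t⁻¹| + ‖x - y + (κ * (s⁻¹ - t⁻¹) : ℝ)‖ = 0 := by
    rcases min_choice ((s + t) / 2) (|s⁻¹ - t⁻¹| + ‖x - y + (κ * (s⁻¹ - t⁻¹) : ℝ)‖) with e | e
    · exact absurd (e.symm.trans h) (half_pos (add_pos hs ht)).ne'
    · exact e.symm.trans h
  rw [add_eq_zero_iff_of_nonneg (abs_nonneg _) (norm_nonneg _), abs_eq_zero, sub_eq_zero,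
    inv_inj] at h'
  obtain ⟨rfl, h'⟩ := h'
  rw [sub_self, mul_zero, AddCircle.coe_zero, add_zero, norm_eq_zero, sub_eq_zero] at h'
  rw [h']

theorem discDist_triangle (κ : ℝ) {a b c : Fin 2 → ℝ} (ha : a ∈ closedDisc) (hb : b ∈ closedDisc)
    (hc : c ∈ closedDisc) : discDist κ a c ≤ discDist κ a b + discDist κ b c := by
  -- This bound settles the triangles with an end point at the centre, whose distance to b is |b|/2.
  have lower : ∀ {a b : Fin 2 → ℝ}, a ∈ closedDisc → b ∈ closedDisc →
      |planeNorm a - planeNorm b| / 2 ≤ discDist κ a b := by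
    intro a b ha hb
    by_cases h0 : a = 0 ∨ b = 0
    · rw [discDist_of_eq_zero h0]
      have := planeNorm_nonneg a
      have := planeNorm_nonneg b
      gcongr
      exact abs_le.2 ⟨by linarith, by linarith⟩
    obtain ⟨s, x, hs, hs', rfl⟩ := exists_eq_smul_circleParam ha fun h => h0 (Or.inl h)
    obtain ⟨t, y, ht, ht', rfl⟩ := exists_eq_smul_circleParam hb fun h => h0 (Or.inr h)
    rw [discDist_smul κ hs ht, planeNorm_smul_circleParam hs.le, planeNorm_smul_circleParam ht.le]
    refine le_min ?_ ?_
    · gcongr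
      exact abs_le.2 ⟨by linarith, by linarith⟩
    · linarith [abs_sub_le_abs_inv_sub_inv hs hs' ht ht', abs_nonneg (s - t),
        norm_nonneg (x - y + (κ * (s⁻¹ - t⁻¹) : ℝ))]
  by_cases h0 : b = 0
  · rw [discDist_of_eq_zero (Or.inr h0), discDist_of_eq_zero (Or.inl h0), h0, planeNorm_zero]
    linarith [discDist_le κ a c]
  by_cases h1 : a = 0
  · rw [discDist_of_eq_zero (Or.inl h1), discDist_of_eq_zero (Or.inl h1), h1, planeNorm_zero]
    linarith [lower hb hc, neg_abs_le (planeNorm b - planeNorm c)]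
  by_cases h2 : c = 0
  · rw [discDist_of_eq_zero (Or.inr h2), discDist_of_eq_zero (Or.inr h2), h2, planeNorm_zero]
    linarith [lower ha hb, le_abs_self (planeNorm a - planeNorm b)]
  obtain ⟨s, x, hs, hs', rfl⟩ := exists_eq_smul_circleParam ha h1
  obtain ⟨t, y, ht, ht', rfl⟩ := exists_eq_smul_circleParam hb h0
  obtain ⟨r, z, hr, hr', rfl⟩ := exists_eq_smul_circleParam hc h2
  rw [discDist_smul κ hs ht, discDist_smul κ hs hr, discDist_smul κ ht hr]
  refine min_half_add_le ht.le ?_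
    ((abs_sub_le_abs_inv_sub_inv hs hs' ht ht').trans (le_add_of_nonneg_right (norm_nonneg _)))
    ((abs_sub_le_abs_inv_sub_inv ht ht' hr hr').trans (le_add_of_nonneg_right (norm_nonneg _)))
  have e : x - z + ((κ * (s⁻¹ - r⁻¹) : ℝ) : AddCircle (2 : ℝ)) =
      (x - y + (κ * (s⁻¹ - t⁻¹) : ℝ)) + (y - z + (κ * (t⁻¹ - r⁻¹) : ℝ)) := by
    rw [show κ * (s⁻¹ - r⁻¹) = κ * (s⁻¹ - t⁻¹) + κ * (t⁻¹ - r⁻¹) by ring, AddCircle.coe_add]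
    abel
  rw [e]
  linarith [abs_sub_le s⁻¹ t⁻¹ r⁻¹,
    norm_add_le (x - y + ((κ * (s⁻¹ - t⁻¹) : ℝ) : AddCircle (2 : ℝ)))
      (y - z + (κ * (t⁻¹ - r⁻¹) : ℝ))]

theorem discDist_nonneg (κ : ℝ) (b b' : Fin 2 → ℝ) : 0 ≤ discDist κ b b' := by
  have := planeNorm_nonneg b
  have := planeNorm_nonneg b'
  unfold discDist
  split_ifs <;> positivity

theorem tendsto_discDist (κ : ℝ) (b : Fin 2 → ℝ) :
    Tendsto (fun b' => discDist κ b' b) (𝓝 b) (𝓝 0) := by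
  by_cases hb : b = 0
  · subst hb
    have h : Tendsto (fun b' : Fin 2 → ℝ => planeNorm b' / 2) (𝓝 0) (𝓝 0) := by
      simpa using (continuous_planeNorm.div_const 2).tendsto 0
    exact h.congr fun b' => by rw [discDist_of_eq_zero (Or.inr rfl), planeNorm_zero, add_zero]
  have hne : {b : Fin 2 → ℝ | b ≠ 0} ∈ 𝓝 b := isOpen_ne.mem_nhds hb
  have hr : ContinuousAt (fun b' : Fin 2 → ℝ => (planeNorm b')⁻¹) b :=
    continuous_planeNorm.continuousAt.inv₀ (planeNorm_pos.2 hb).ne'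
  have hd := hr.sub (continuousAt_const (y := (planeNorm b)⁻¹))
  have ha := (continuousOn_angle.continuousAt hne).sub
    (continuousAt_const (y := (angle b : AddCircle (2 : ℝ))))
  have hs := ((AddCircle.continuous_mk' (2 : ℝ)).continuousAt (x := κ * ((planeNorm b)⁻¹ -
    (planeNorm b)⁻¹))).comp (f := fun b' => κ * ((planeNorm b')⁻¹ - (planeNorm b)⁻¹))
      (continuousAt_const.mul hd)
  have h : Tendsto (fun b' => |(planeNorm b')⁻¹ - (planeNorm b)⁻¹| +
      ‖(angle b' : AddCircle (2 : ℝ)) - angle b +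
        (κ * ((planeNorm b')⁻¹ - (planeNorm b)⁻¹) : ℝ)‖) (𝓝 b)
      (𝓝 (|(planeNorm b)⁻¹ - (planeNorm b)⁻¹| + ‖(angle b : AddCircle (2 : ℝ)) - angle b +
        (κ * ((planeNorm b)⁻¹ - (planeNorm b)⁻¹) : ℝ)‖)) :=
    (hd.abs.add (ha.add hs).norm).tendsto
  simp only [sub_self, abs_zero, mul_zero, AddCircle.coe_zero, add_zero, norm_zero] at h
  refine tendsto_of_tendsto_of_tendsto_of_le_of_le' tendsto_const_nhds h
    (Eventually.of_forall fun b' => discDist_nonneg κ b' b) ?_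
  · filter_upwards [hne] with b' hb'
    rw [discDist, if_neg (not_or.2 ⟨hb', hb⟩), AddCircle.coe_add, AddCircle.coe_sub]
    exact min_le_right _ _

/-- By the triangle inequality, d(p, q) differs from d(b, c) by at most d(p, b) + d(q, c), so
continuity at the diagonal suffices. -/
theorem continuousOn_discDist (κ : ℝ) :
    ContinuousOn (fun p : (Fin 2 → ℝ) × (Fin 2 → ℝ) => discDist κ p.1 p.2)
      (closedDisc ×ˢ closedDisc) := by
  rintro ⟨b, c⟩ ⟨hb, hc⟩
  have h : Tendsto (fun p : (Fin 2 → ℝ) × (Fin 2 → ℝ) => discDist κ p.1 b + discDist κ p.2 c)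
      (𝓝[closedDisc ×ˢ closedDisc] (b, c)) (𝓝 0) := by
    have h1 := (tendsto_discDist κ b).comp (continuous_fst.tendsto (b, c))
    have h2 := (tendsto_discDist κ c).comp (continuous_snd.tendsto (b, c))
    simpa using (h1.add h2).mono_left nhdsWithin_le_nhds
  rw [ContinuousWithinAt, tendsto_iff_dist_tendsto_zero]
  refine squeeze_zero' (Eventually.of_forall fun _ => dist_nonneg) ?_ h
  filter_upwards [self_mem_nhdsWithin] with p hp
  have hp1 := hp.1
  have hp2 := hp.2
  rw [Real.dist_eq, abs_le]
  constructor
  · linarith [discDist_triangle κ hb hp1 hc, discDist_triangle κ hp1 hp2 hc, discDist_comm κ b p.1]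
  · linarith [discDist_triangle κ hp1 hb hp2, discDist_triangle κ hb hc hp2, discDist_comm κ c p.2]

theorem foldedAbs_nonneg (w : ℝ) : 0 ≤ foldedAbs w := by
  unfold foldedAbs
  positivity

/-- A semialgebraic expression for `discDist`. -/
theorem discDist_eq_foldedAbs {κ : ℝ} (hκ : |κ| ≤ 1) {b b' : Fin 2 → ℝ} (hb : b ∈ closedDisc)
    (hb' : b' ∈ closedDisc) (h0 : ¬ (b = 0 ∨ b' = 0)) :
    discDist κ b b' = min ((planeNorm b + planeNorm b') / 2)
      (|(planeNorm b)⁻¹ - (planeNorm b')⁻¹| +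
        foldedAbs (angle b - angle b' + κ * ((planeNorm b)⁻¹ - (planeNorm b')⁻¹))) := by
  rw [discDist, if_neg h0]
  -- If the inverse radii differ by more than 1, the cut-off, being at most 1, is the minimum on
  -- both sides. Otherwise the shear is at most 1 and the angular argument stays in [-3, 3].
  by_cases h : |(planeNorm b)⁻¹ - (planeNorm b')⁻¹| ≤ 1
  · rw [norm_addCircle_two_eq_min, foldedAbs]
    have h1 := angle_mem_Ico b
    have h2 := angle_mem_Ico b'
    have h3 : |κ * ((planeNorm b)⁻¹ - (planeNorm b')⁻¹)| ≤ 1 := by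
      rw [abs_mul]
      exact mul_le_one₀ hκ (abs_nonneg _) h
    rw [abs_le] at h3 ⊢
    exact ⟨by linarith [h1.1, h2.2], by linarith [h1.2, h2.1]⟩
  · have h1 : (planeNorm b + planeNorm b') / 2 ≤ 1 := by
      have e1 : planeNorm b ≤ 1 := hb
      have e2 : planeNorm b' ≤ 1 := hb'
      linarith
    have h2 := h1.trans (not_le.1 h).le
    rw [min_eq_left (h2.trans (le_add_of_nonneg_right (norm_nonneg _))),
      min_eq_left (h2.trans (le_add_of_nonneg_right (foldedAbs_nonneg _)))]

theorem isSemialgebraic_preimage_closedDisc {ι : Type} {f : (ι → ℝ) → Fin 2 → ℝ}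
    (hf : ∀ i, IsTameFun fun z => f z i) : IsSemialgebraic {z | f z ∈ closedDisc} :=
  (IsTameFun.planeNorm hf).isSemialgebraic_le (.const 1)

theorem isCompactSemialgebraicMetricSpace_discDist {κ : ℝ} (hκ : |κ| ≤ 1) :
    IsCompactSemialgebraicMetricSpace closedDisc (discDist κ) := by
  refine ⟨isCompact_closedDisc, ?_, fun _ hx _ hy => discDist_eq_zero_iff κ hx hy,
    fun _ _ _ _ => discDist_comm κ _ _, fun _ hx _ hy _ hz => discDist_triangle κ hx hy hz,
    continuousOn_discDist κ, ?_⟩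
  · exact isSemialgebraic_preimage_closedDisc .coord
  have hl (i) : IsTameFun fun z : (Fin 2 ⊕ Fin 2) ⊕ Fin 1 → ℝ => z (Sum.inl (Sum.inl i)) :=
    .coord _
  have hr (i) : IsTameFun fun z : (Fin 2 ⊕ Fin 2) ⊕ Fin 1 → ℝ => z (Sum.inl (Sum.inr i)) :=
    .coord _
  have hNl := IsTameFun.planeNorm hl
  have hNr := IsTameFun.planeNorm hr
  have hz : IsSemialgebraic {z : (Fin 2 ⊕ Fin 2) ⊕ Fin 1 → ℝ |
      (fun i => z (Sum.inl (Sum.inl i))) = 0 ∨ (fun i => z (Sum.inl (Sum.inr i))) = 0} := by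
    simp only [← planeNorm_eq_zero]
    exact (hNl.isSemialgebraic_eq (.const 0)).union (hNr.isSemialgebraic_eq (.const 0))
  have hh := (hNl.add hNr).div (.const 2)
  have hi := hNl.inv.sub hNr.inv
  have hD := hh.min (hi.abs.add (((IsTameFun.angle hl).sub (IsTameFun.angle hr)).add
    ((IsTameFun.const κ).mul hi)).foldedAbs)
  have hdom := (isSemialgebraic_preimage_closedDisc hl).inter
    (isSemialgebraic_preimage_closedDisc hr)
  have hc : IsTameFun fun z : (Fin 2 ⊕ Fin 2) ⊕ Fin 1 → ℝ => z (Sum.inr 0) := .coord _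
  convert hdom.inter (((hz.inter (hc.isSemialgebraic_eq hh))).union
    (hz.compl.inter (hc.isSemialgebraic_eq hD))) using 1
  ext z
  rw [Set.mem_ofPred_eq, ← and_assoc]
  refine and_congr_right fun ⟨hb, hb'⟩ => ?_
  by_cases h0 : (fun i => z (Sum.inl (Sum.inl i))) = 0 ∨ (fun i => z (Sum.inl (Sum.inr i))) = 0
  · rw [discDist_of_eq_zero h0]
    exact ⟨fun h => Or.inl ⟨h0, h⟩, fun h => h.elim And.right fun h => absurd h0 h.1⟩
  · rw [discDist_eq_foldedAbs hκ hb hb' h0]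
    exact ⟨fun h => Or.inr ⟨h0, h⟩, fun h => h.elim (fun h => absurd h.1 h0) And.right⟩

/-! ### Isometries between the two metrics -/

theorem discDist_zero_left (κ : ℝ) (b : Fin 2 → ℝ) : discDist κ 0 b = planeNorm b / 2 := by
  rw [discDist_of_eq_zero (Or.inl rfl), planeNorm_zero, zero_add]

/-- The boundary point whose sheared angle is opposite to that of b is a witness: the angular term
is then 1. The centre has no such point, so isometries fix it. -/
theorem exists_half_lt_discDist (κ : ℝ) {b : Fin 2 → ℝ} (hb : b ∈ closedDisc) (h0 : b ≠ 0) :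
    ∃ b' ∈ closedDisc, 1 / 2 < discDist κ b b' := by
  obtain ⟨s, x, hs, hs', rfl⟩ := exists_eq_smul_circleParam hb h0
  refine ⟨(1 : ℝ) • circleParam (x + (κ * (s⁻¹ - 1⁻¹) : ℝ) - (1 : ℝ)),
    smul_circleParam_mem zero_le_one le_rfl _, ?_⟩
  rw [discDist_smul κ hs one_pos]
  have h1 : ‖((1 : ℝ) : AddCircle (2 : ℝ))‖ = 1 := by
    rw [norm_addCircle_two_eq_abs (by simp), abs_one]
  refine lt_min (by linarith) ?_
  rw [show x - (x + ((κ * (s⁻¹ - 1⁻¹) : ℝ) : AddCircle (2 : ℝ)) - ((1 : ℝ) : AddCircle (2 : ℝ))) +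
    ((κ * (s⁻¹ - 1⁻¹) : ℝ) : AddCircle (2 : ℝ)) = ((1 : ℝ) : AddCircle (2 : ℝ)) by abel, h1]
  linarith [abs_nonneg (s⁻¹ - 1⁻¹)]

theorem IsIsometryOnto.map_zero_disc {κ κ' : ℝ} {Ψ : (Fin 2 → ℝ) → Fin 2 → ℝ}
    (hΨ : IsIsometryOnto closedDisc (discDist κ) closedDisc (discDist κ') Ψ) :
    Ψ 0 = 0 := by
  by_contra h0
  obtain ⟨c, hc, hlt⟩ := exists_half_lt_discDist κ' (hΨ.1.mapsTo zero_mem_closedDisc) h0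
  obtain ⟨b, hb, rfl⟩ := hΨ.1.surjOn hc
  rw [hΨ.2 0 zero_mem_closedDisc b hb, discDist_zero_left] at hlt
  have : planeNorm b ≤ 1 := hb
  linarith

theorem IsIsometryOnto.planeNorm_map_disc {κ κ' : ℝ} {Ψ : (Fin 2 → ℝ) → Fin 2 → ℝ}
    (hΨ : IsIsometryOnto closedDisc (discDist κ) closedDisc (discDist κ') Ψ)
    {b : Fin 2 → ℝ} (hb : b ∈ closedDisc) :
    planeNorm (Ψ b) = planeNorm b := by
  have h := hΨ.2 0 zero_mem_closedDisc b hb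
  rw [hΨ.map_zero_disc, discDist_zero_left, discDist_zero_left] at h
  linarith

theorem isIsometryOnto_rigid {Ψ : (Fin 2 → ℝ) → Fin 2 → ℝ}
    (hΨ : IsIsometryOnto closedDisc (discDist 1) closedDisc (discDist 0) Ψ) :
    ∃ c ε : ℝ, (ε = 1 ∨ ε = -1) ∧ ∀ x ∈ strip,
      Ψ (polarMap circleCover x) = polarMap circleCover ![x 0, c + ε * (x 1 + twist (x 0))] := by
  -- the angle of the image of the point at radius `s` on the spiral through `circleCover u`
  obtain ⟨A, hA⟩ : ∃ A : ℝ → ℝ → ℝ, ∀ s u, 0 < s → s ≤ 1 →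
      Ψ (s • circleCover (u - twist s)) = s • circleCover (A s u) := by
    refine ⟨fun s u => angle (Ψ (s • circleCover (u - twist s))), fun s u hs hs' => ?_⟩
    have hn := hΨ.planeNorm_map_disc (smul_circleParam_mem hs.le hs' (u - twist s : ℝ))
    rw [planeNorm_smul_circleParam hs.le] at hn
    have h0 : Ψ (s • circleParam (u - twist s : ℝ)) ≠ 0 := by
      rw [← planeNorm_pos, hn]
      exact hs
    exact (planeNorm_smul_circleParam_angle h0).symm.trans (by rw [hn]; rfl)
  -- In the twisted angle u the shear of the source metric cancels, and both metrics take the same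
  -- form.
  have key : ∀ s t u v, 0 < s → s ≤ 1 → 0 < t → t ≤ 1 →
      min ((s + t) / 2) (|s⁻¹ - t⁻¹| + ‖((A s u - A t v : ℝ) : AddCircle (2 : ℝ))‖) =
        min ((s + t) / 2) (|s⁻¹ - t⁻¹| + ‖((u - v : ℝ) : AddCircle (2 : ℝ))‖) := by
    intro s t u v hs hs' ht ht'
    have h := hΨ.2 _ (smul_circleParam_mem hs.le hs' (u - twist s : ℝ))
      _ (smul_circleParam_mem ht.le ht' (v - twist t : ℝ))
    change discDist 0 (Ψ (s • circleCover (u - twist s))) (Ψ (t • circleCover (v - twist t))) = _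
      at h
    rw [hA s u hs hs', hA t v ht ht', circleCover, circleCover, discDist_smul 0 hs ht,
      discDist_smul 1 hs ht, ← AddCircle.coe_sub, ← AddCircle.coe_sub, ← AddCircle.coe_add,
      ← AddCircle.coe_add, zero_mul, add_zero,
      show u - twist s - (v - twist t) + 1 * (s⁻¹ - t⁻¹) = u - v by simp only [twist]; ring] at h
    exact h
  have hconst : ∀ s u, 0 < s → s ≤ 1 → (A s u : AddCircle (2 : ℝ)) = A 1 u := by
    intro s u hs hs'
    -- It suffices that the class of A s u is locally constant in s. For t near s the cut-off is
    -- inactive and the source distance is |1/s - 1/t|, which forces the angular term of the images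
    -- to vanish.
    refine (isPreconnected_Ioc (a := (0 : ℝ)) (b := 1)).induction₂
      (fun s t => (A s u : AddCircle (2 : ℝ)) = A t u) ?_ (fun _ _ _ _ _ _ => Eq.trans)
      (fun _ _ _ _ => Eq.symm) ⟨hs, hs'⟩ ⟨one_pos, le_rfl⟩
    intro s hs
    have hcont : ContinuousAt (fun t : ℝ => |s⁻¹ - t⁻¹| - (s + t) / 2) s :=
      ((continuousAt_const.sub (continuousAt_id.inv₀ hs.1.ne')).abs).sub (by fun_prop)
    have hlt : |s⁻¹ - s⁻¹| - (s + s) / 2 < 0 := by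
      rw [sub_self, abs_zero]
      linarith [hs.1]
    filter_upwards [self_mem_nhdsWithin,
      (hcont.eventually_lt_const hlt).filter_mono nhdsWithin_le_nhds] with t ht htlt
    have h := key s t u u hs.1 hs.2 ht.1 ht.2
    rw [sub_self, AddCircle.coe_zero, norm_zero, add_zero, min_eq_right (sub_neg.1 htlt).le] at h
    have h' : |s⁻¹ - t⁻¹| + ‖((A s u - A t u : ℝ) : AddCircle (2 : ℝ))‖ = |s⁻¹ - t⁻¹| := by
      rcases min_choice ((s + t) / 2)
        (|s⁻¹ - t⁻¹| + ‖((A s u - A t u : ℝ) : AddCircle (2 : ℝ))‖) with e | e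
      · linarith
      · exact e.symm.trans h
    rwa [add_eq_left, norm_eq_zero, AddCircle.coe_sub, sub_eq_zero] at h'
  -- On the boundary the cut-off is 1, the largest value of the norm, so the metric there is exactly
  -- that of ℝ/2ℤ.
  obtain ⟨c, ε, hε, hc⟩ := addCircle_isometry_classification (h := A 1) fun u v => by
    have h := key 1 1 u v one_pos le_rfl one_pos le_rfl
    norm_num only [sub_self, abs_zero, zero_add] at h
    rwa [min_eq_right (norm_addCircle_two_le_one _), min_eq_right (norm_addCircle_two_le_one _)]
      at h
  refine ⟨c, ε, hε, fun x hx => ?_⟩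
  have h := hA (x 0) (x 1 + twist (x 0)) hx.1 hx.2
  rw [add_sub_cancel_right] at h
  rw [polarMap, polarMap, h, circleCover, hconst _ _ hx.1 hx.2, hc]
  rfl

theorem areIsometric_discDist : AreIsometric closedDisc (discDist 1) closedDisc (discDist 0) := by
  -- Rotation by τ/|b| fixes the centre; τ = 1 removes the shear, and τ = -1 gives the inverse.
  let rot (τ : ℝ) (b : Fin 2 → ℝ) : Fin 2 → ℝ :=
    planeNorm b • circleParam (angle b + (τ * (planeNorm b)⁻¹ : ℝ))
  have rot_zero (τ : ℝ) : rot τ 0 = 0 := by simp [rot]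
  have rot_smul (τ : ℝ) {s : ℝ} (hs : 0 < s) (x : AddCircle (2 : ℝ)) :
      rot τ (s • circleParam x) = s • circleParam (x + (τ * s⁻¹ : ℝ)) := by
    simp only [rot, planeNorm_smul_circleParam hs.le, angle_smul_circleParam hs]
  have rot_mem (τ : ℝ) {b : Fin 2 → ℝ} (hb : b ∈ closedDisc) : rot τ b ∈ closedDisc :=
    smul_circleParam_mem (planeNorm_nonneg b) hb _
  have hiso : ∀ b ∈ closedDisc, ∀ b' ∈ closedDisc,
      discDist 0 (rot 1 b) (rot 1 b') = discDist 1 b b' := by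
    intro b hb b' hb'
    by_cases h0 : b = 0
    · rw [h0, rot_zero, discDist_zero_left, discDist_zero_left,
        planeNorm_smul_circleParam (planeNorm_nonneg b')]
    by_cases h0' : b' = 0
    · rw [h0', rot_zero, discDist_comm 0, discDist_comm 1, discDist_zero_left, discDist_zero_left,
        planeNorm_smul_circleParam (planeNorm_nonneg b)]
    obtain ⟨s, x, hs, -, rfl⟩ := exists_eq_smul_circleParam hb h0
    obtain ⟨t, y, ht, -, rfl⟩ := exists_eq_smul_circleParam hb' h0'
    rw [rot_smul 1 hs, rot_smul 1 ht, discDist_smul 0 hs ht, discDist_smul 1 hs ht]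
    congr 3
    simp only [zero_mul, one_mul, AddCircle.coe_sub, AddCircle.coe_zero]
    abel
  refine ⟨rot 1, ⟨fun b hb => rot_mem 1 hb, fun b hb b' hb' h => ?_, fun b hb => ?_⟩, hiso⟩
  · rw [← discDist_eq_zero_iff 1 hb hb', ← hiso b hb b' hb', h, discDist_self]
  · refine ⟨rot (-1) b, rot_mem (-1) hb, ?_⟩
    by_cases h0 : b = 0
    · rw [h0, rot_zero, rot_zero]
    obtain ⟨s, x, hs, -, rfl⟩ := exists_eq_smul_circleParam hb h0
    rw [rot_smul (-1) hs, rot_smul 1 hs, add_assoc, ← AddCircle.coe_add]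
    simp

/-- A radius is sent to a spiral, which meets another radius in a set of radii that accumulates at
`0` without containing an interval `(0, δ)`. -/
theorem not_isSemialgebraicMapOn_of_spiral {Ψ : (Fin 2 → ℝ) → Fin 2 → ℝ} {c ε : ℝ}
    (hε : ε = 1 ∨ ε = -1) (h : ∀ x ∈ strip,
      Ψ (polarMap circleCover x) = polarMap circleCover ![x 0, c + ε * (x 1 + twist (x 0))]) :
    ¬ IsSemialgebraicMapOn Ψ closedDisc := by
  intro hsa
  -- The graph of Ψ is tested along the line t ↦ (t g(0), t g(c)), with g the circle
  -- parametrization. At t = 1/(w + 1) the twist equals w, so the point lies on the graph exactly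
  -- when w is an even integer. Odd w then refute eventual membership, and even w eventual
  -- non-membership.
  have hmem : ∀ w : ℝ, 0 ≤ w →
      ((fun i => ((Sum.elim (fun i => Polynomial.X * Polynomial.C (circleCover 0 i))
        (fun i => Polynomial.X * Polynomial.C (circleCover c i)) : Fin 2 ⊕ Fin 2 → Polynomial ℝ)
          i).eval (w + 1)⁻¹) ∈ {z : Fin 2 ⊕ Fin 2 → ℝ | z ∘ Sum.inl ∈ closedDisc ∧
            z ∘ Sum.inr = Ψ (z ∘ Sum.inl)} ↔ (w : AddCircle (2 : ℝ)) = 0) := by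
    intro w hw
    have hpos : 0 < (w + 1)⁻¹ := by positivity
    have hle : (w + 1)⁻¹ ≤ 1 := inv_le_one_of_one_le₀ (by linarith)
    have h' := h ![(w + 1)⁻¹, 0] ⟨hpos, hle⟩
    simp only [polarMap, twist, Matrix.cons_val_zero, Matrix.cons_val_one, inv_inv, zero_add,
      add_sub_cancel_right] at h'
    have e : ∀ v : ℝ, (fun i => (w + 1)⁻¹ * circleCover v i) = (w + 1)⁻¹ • circleCover v :=
      fun v => rfl
    simp only [Set.mem_ofPred_eq, Function.comp_def, Sum.elim_inl, Sum.elim_inr,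
      Polynomial.eval_mul, Polynomial.eval_X, Polynomial.eval_C, e, h']
    have hmem : (w + 1)⁻¹ • circleCover 0 ∈ closedDisc := smul_circleParam_mem hpos.le hle _
    rw [and_iff_right hmem, smul_right_inj hpos.ne', circleCover, circleCover, circleParam_injective.eq_iff, AddCircle.coe_add, eq_comm, add_eq_left]
    rcases hε with rfl | rfl
    · rw [one_mul]
    · rw [neg_one_mul, AddCircle.coe_neg, neg_eq_zero]
  have htend : Tendsto (fun n : ℕ => ((n : ℝ) + 1)⁻¹) atTop (𝓝[>] 0) :=
    tendsto_inv_atTop_nhdsGT_zero.comp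
      (tendsto_atTop_add_const_right _ 1 tendsto_natCast_atTop_atTop)
  rcases hsa.eventually_mem_or_eventually_notMem
    (Sum.elim (fun i => Polynomial.X * Polynomial.C (circleCover 0 i))
      fun i => Polynomial.X * Polynomial.C (circleCover c i)) with hev | hev
  · obtain ⟨N, hN⟩ := eventually_atTop.1 (htend.eventually hev)
    have hw := (hmem _ (Nat.cast_nonneg (2 * N + 1))).1 (hN (2 * N + 1) (by omega))
    rw [AddCircle.coe_eq_zero_iff] at hw
    obtain ⟨n, hn⟩ := hw
    have hn' : (n : ℝ) * 2 = 2 * N + 1 := by simpa using hn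
    have : n * 2 = 2 * (N : ℤ) + 1 := by exact_mod_cast hn'
    omega
  · obtain ⟨N, hN⟩ := eventually_atTop.1 (htend.eventually hev)
    refine hN (2 * N) (by omega) ((hmem _ (Nat.cast_nonneg (2 * N))).2 ?_)
    rw [AddCircle.coe_eq_zero_iff]
    exact ⟨N, by simp [mul_comm]⟩

theorem theorem2 :
    ∃ (dX : (Fin 2 → ℝ) → (Fin 2 → ℝ) → ℝ) (g : ℝ → (Fin 2 → ℝ)) (φ : ℝ → ℝ)
      (d d' : (Fin 2 → ℝ) → (Fin 2 → ℝ) → ℝ),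
      -- the metric on `(0, 1] × ℝ`, invariant under translations of the second factor
      IsSemialgebraicMetricSpace strip dX ∧
      (∀ x ∈ strip, ∀ y ∈ strip, ∀ a : ℝ, dX ![x 0, x 1 + a] ![y 0, y 1 + a] = dX x y) ∧
      IsPeriodicSemialgebraicCovering g ∧
      IsTwistFunction φ ∧
      -- the two metrics on the disc
      IsPushedDown g dX d ∧
      IsPushedDown g (twistedDist φ dX) d' ∧
      IsCompactSemialgebraicMetricSpace closedDisc d ∧
      IsCompactSemialgebraicMetricSpace closedDisc d' ∧
      -- they are isometric, but not semialgebraically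
      AreIsometric closedDisc d' closedDisc d ∧
      ¬ AreSemialgebraicallyIsometric closedDisc d' closedDisc d ∧
      -- every isometry sends every radius to an infinite spiral
      (∀ Ψ, IsIsometryOnto closedDisc d' closedDisc d Ψ →
        ∃ c ε : ℝ, (ε = 1 ∨ ε = -1) ∧ ∀ x ∈ strip,
          Ψ (polarMap g x) = polarMap g ![x 0, c + ε * (x 1 + φ (x 0))]) := by
  refine ⟨stripDist 0, circleCover, twist, discDist 0, discDist 1,
    isSemialgebraicMetricSpace_strip, fun x _ y _ a => stripDist_translate 0 x y a,
    isPeriodicSemialgebraicCovering_circleCover, isTwistFunction_twist, isPushedDown_discDist 0,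
    twistedDist_stripDist ▸ isPushedDown_discDist 1,
    isCompactSemialgebraicMetricSpace_discDist (by simp),
    isCompactSemialgebraicMetricSpace_discDist (by simp), areIsometric_discDist, ?_,
    fun Ψ hΨ => isIsometryOnto_rigid hΨ⟩
  rintro ⟨Ψ, hΨ, hsa⟩
  obtain ⟨c, ε, hε, h⟩ := isIsometryOnto_rigid hΨ
  exact not_isSemialgebraicMapOn_of_spiral hε h hsa
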